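/- **Theorem 11.3.** Let $k\ge 1$ be an integer, $\beta>0$ and $0<c<1$. Write $(a)_0=1$, $(a)_n=a(a+1)\cdots(a+n-1)$ for the Pochhammer symbol and $$F(u,v;w;z)={}_2F_1\left(\left.{u,\ v\atop w}\right|z\right)=\sum_{n\ge 0}\frac{(u)_n(v)_n}{(w)_n}\frac{z^n}{n!}.$$ Let $\omega(x)=\frac{(\beta)_x}{x!}c^x$ be the Meixner weight on $\mathbb Z_{\ge 0}$, let $P_n(\zeta)=(\beta)_n(1-1/c)^{-n}F(-n,-\zeta;\beta;1-1/c)$ be the normalized (monic) Meixner polynomials, and $\|P_n\|^2=\sum_{x\ge0}P_n(x)^2\omega(x)$. Let $K$ be the kernel on $\mathbb Z_{\ge0}\times\mathbb Z_{\ge0}$ given by $$K(x,y)=\|P_{k-1}\|^{-2}\sqrt{\omega(x)\omega(y)}\,\frac{P_k(x)P_{k-1}(y)-P_{k-1}(x)P_k(y)}{x-y}\quad(x\ne y),$$ $$K(x,x)=\|P_{k-1}\|^{-2}\,\omega(x)\bigl(P_k'(x)P_{k-1}(x)-P_{k-1}'(x)P_k(x)\bigr),$$ and for $s\ge k$ let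 $D_s=\det\bigl(1-K|_{\{s,s+1,\dots\}\times\{s,s+1,\dots\}}\bigr)$ be the Fredholm determinant (defined by its expansion $\sum_S(-1)^{|S|}\det(K(x,y))_{x,y\in S}$ over the finite subsets $S$ of $\{s,s+1,\dots\}$). Then for every $s\ge k$ this expansion converges absolutely and $D_s\neq0$. There exist real sequences $(e_s)_{s\ge k}$, $(f_s)_{s\ge k}$, $(g_s)_{s\ge k}$, $(h_s)_{s\ge k}$ with the initial values $$e_k=\frac{\beta c\,((k-1)!)^2}{F(1-k,1-k;1+\beta;1/c)},\qquad f_k=0,\qquad g_k=\frac{k}{\beta c}\cdot\frac{F(1-k,1-k;1+\beta;1/c)}{F(-k,1-k;\beta;1/c)},\qquad h_k=k!,$$ satisfying, for all $s\ge k$, the recurrence relations $$e_{s+1}=-\frac{c\,e_sg_s}{g_{s+1}}\cdot\frac{(1+g_{s+1})f_{s+1}+(\beta+k-1)g_{s+1}-s-1}{(1+cg_s)f_{s+1}+k-s-1},$$ $$f_{s+1}=1-\beta-k-f_s+\frac{s}{1+g_s}+\frac{\beta+s}{1+cg_s},\qquad g_{s+1}=\frac{(f_{s+1}-1-s)(f_{s+1}-1-s+k)}{c\,g_s\,f_{s+1}(f_{s+1}+\beta+k-1)},$$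 $$h_{s+1}=\frac{(1+cg_s)(s+1-f_{s+1})}{c(\beta+s)g_s}\,h_s,$$ and these relations can be run from the initial values for all $s\ge k$ without meeting a zero denominator: the two values of $F$ in the denominators above are nonzero and, for all $s\ge k$, the numbers $e_s$, $g_s$, $1+g_s$, $1+cg_s$, $f_{s+1}$, $f_{s+1}+\beta+k-1$ and $(1+cg_s)f_{s+1}+k-s-1$ are nonzero. (In particular the sequences are unique.) The Fredholm determinants are computed by them: for all $s\ge k$, $$\frac{D_{s+2}}{D_{s+1}}-\frac{D_{s+1}}{D_s}=\frac{(\beta)_s}{\beta+s}\cdot\frac{c^{s-1}}{(s+1)!}\cdot\frac{1+cg_s}{e_sg_s^2}\cdot\bigl[(1+cg_s)f_{s+1}-s-1\bigr]\cdot h_s^2,$$ with initial values $$D_k=(1-c)^{k(\beta+k-1)},\qquad D_{k+1}=\frac{(\beta)_k}{k!}\,c^k(1-c)^{k(\beta+k-1)}F(-k,-k;\beta;1/c).$$ Moreover, for every $s\ge k$, the passage from $(f_s,g_s)$ to $(f_{s+1},g_{s+1})$ is a step of Sakai's difference Painlevé V equation $d\text{-}P_V$ with the additional parameter $t=c$,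 namely of $$\bar f+f=a_3+\frac{a_1}{1+g}+\frac{a_0}{1+tg},\qquad \bar g\,g=\frac{(\bar f+a_2-\lambda)(\bar f+a_2-\lambda+a_4)}{t\,\bar f(\bar f-a_3)},$$ $$\bar a_0=a_0+\lambda,\quad \bar a_1=a_1+\lambda,\quad \bar a_2=a_2-\lambda,\quad \bar a_3=a_3,\quad \bar a_4=a_4,\qquad \lambda=a_0+a_1+2a_2+a_3+a_4,$$ with nonvanishing denominators, where at time $s$ the parameters are $a_0=\beta+s$, $a_1=s$, $a_2=-s$, $a_3=-(k+\beta-1)$, $a_4=k$ (so $\lambda=1$). -/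

import Mathlib

open scoped Nat

/-- A term of the Fredholm expansion of `det (1 - K)`, for a kernel `K` on a discrete set `ι` (with
counting measure). The `n`-th Fredholm term
`(-1)^n / n! * ∑_{x₁,…,xₙ} det (K (xᵢ, xⱼ))` is `(-1)^n` times the sum over the `n`-element subsets
of `ι`, because the determinant is symmetric in the points and vanishes if two of them coincide. -/
noncomputable def fredholmTerm {ι : Type*} [DecidableEq ι] (K : ι → ι → ℝ) (S : Finset ι) : ℝ :=
  (-1) ^ S.card * (Matrix.of fun i j : S => K i j).det

/-- The Fredholm determinant `det (1 - K)`: the sum of its expansion over all finite subsets. -/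
noncomputable def fredholmDet {ι : Type*} [DecidableEq ι] (K : ι → ι → ℝ) : ℝ :=
  ∑' S : Finset ι, fredholmTerm K S

/-- The restriction of a kernel on `ℕ` to `{s, s + 1, s + 2, …}`. -/
def restrictKernel (K : ℕ → ℕ → ℝ) (s : ℕ) : Set.Ici s → Set.Ici s → ℝ :=
  fun x y => K x y

/-- The Pochhammer symbol `(a)_n = a (a + 1) ⋯ (a + n - 1)`. -/
noncomputable def poch (a : ℝ) (n : ℕ) : ℝ := (ascPochhammer ℝ n).eval a

/-- The Meixner weight `(β)_x c^x / x!` on the nonnegative integers. -/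
noncomputable def meixnerWeight (β c : ℝ) (x : ℕ) : ℝ := poch β x / (x ! : ℝ) * c ^ x

/-- The Meixner polynomial `M_n(ζ; β, c)`. -/
noncomputable def meixner (β c : ℝ) (n : ℕ) (ζ : ℝ) : ℝ :=
  ₂F₁ (-(n : ℝ)) (-ζ) β (1 - 1 / c)

/-- The normalized (monic) Meixner polynomial, as a function of a real variable. -/
noncomputable def monicMeixner (β c : ℝ) (n : ℕ) (ζ : ℝ) : ℝ :=
  poch β n * ((1 - 1 / c) ^ n)⁻¹ * meixner β c n ζ

/-- The squared norm of the `n`-th monic Meixner polynomial with respect to the Meixner weight. -/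
noncomputable def meixnerNormSq (β c : ℝ) (n : ℕ) : ℝ :=
  ∑' x : ℕ, monicMeixner β c n x ^ 2 * meixnerWeight β c x

/-- The `k`-th Christoffel–Darboux kernel of the Meixner polynomials (for `1 ≤ k`). -/
noncomputable def meixnerKernel (k : ℕ) (β c : ℝ) (x y : ℕ) : ℝ :=
  if x = y then
    (meixnerNormSq β c (k - 1))⁻¹ * meixnerWeight β c x *
      (deriv (monicMeixner β c k) x * monicMeixner β c (k - 1) x
        - deriv (monicMeixner β c (k - 1)) x * monicMeixner β c k x)
  else
    (meixnerNormSq β c (k - 1))⁻¹ * √(meixnerWeight β c x * meixnerWeight β c y) *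
      ((monicMeixner β c k x * monicMeixner β c (k - 1) y
        - monicMeixner β c (k - 1) x * monicMeixner β c k y) / ((x : ℝ) - (y : ℝ)))

/-- `D_s`, the Fredholm determinant of `1 - K` on `{s, s + 1, s + 2, …}`. -/
noncomputable def meixnerD (k : ℕ) (β c : ℝ) (s : ℕ) : ℝ :=
  fredholmDet (restrictKernel (meixnerKernel k β c) s)

/-- The sequences `e, f, g, h` (only their values at indices `s ≥ k` matter) have the prescribed
initial values and satisfy the prescribed recurrence relations, and no denominator occurring in
these formulas vanishes. -/
structure IsMeixnerSolution (k : ℕ) (β c : ℝ) (e f g h : ℕ → ℝ) : Prop where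
  init_ne : ₂F₁ (1 - (k : ℝ)) (1 - (k : ℝ)) (1 + β) (1 / c) ≠ 0 ∧
    ₂F₁ (-(k : ℝ)) (1 - (k : ℝ)) β (1 / c) ≠ 0
  init_e : e k = β * c * ((k - 1)! : ℝ) ^ 2 /
    ₂F₁ (1 - (k : ℝ)) (1 - (k : ℝ)) (1 + β) (1 / c)
  init_f : f k = 0
  init_g : g k = k / (β * c) *
    (₂F₁ (1 - (k : ℝ)) (1 - (k : ℝ)) (1 + β) (1 / c) /
      ₂F₁ (-(k : ℝ)) (1 - (k : ℝ)) β (1 / c))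
  init_h : h k = (k ! : ℝ)
  e_ne : ∀ s, k ≤ s → e s ≠ 0
  g_ne : ∀ s, k ≤ s → g s ≠ 0
  one_add_g_ne : ∀ s, k ≤ s → 1 + g s ≠ 0
  one_add_cg_ne : ∀ s, k ≤ s → 1 + c * g s ≠ 0
  f_ne : ∀ s, k ≤ s → f (s + 1) ≠ 0
  f_add_ne : ∀ s, k ≤ s → f (s + 1) + β + k - 1 ≠ 0
  e_den_ne : ∀ s, k ≤ s → (1 + c * g s) * f (s + 1) + k - s - 1 ≠ 0
  rec_e : ∀ s, k ≤ s → e (s + 1) = -(c * e s * g s / g (s + 1)) *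
    (((1 + g (s + 1)) * f (s + 1) + (β + k - 1) * g (s + 1) - s - 1) /
      ((1 + c * g s) * f (s + 1) + k - s - 1))
  rec_f : ∀ s, k ≤ s → f (s + 1) =
    1 - β - k - f s + s / (1 + g s) + (β + s) / (1 + c * g s)
  rec_g : ∀ s, k ≤ s → g (s + 1) =
    (f (s + 1) - 1 - s) * (f (s + 1) - 1 - s + k) /
      (c * g s * f (s + 1) * (f (s + 1) + β + k - 1))
  rec_h : ∀ s, k ≤ s → h (s + 1) =
    (1 + c * g s) * (s + 1 - f (s + 1)) / (c * (β + s) * g s) * h s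

/-- A state of the difference Painlevé V equation: the parameters `a₀, …, a₄` and the
dependent variables `f, g`. -/
structure DPVState where
  a₀ : ℝ
  a₁ : ℝ
  a₂ : ℝ
  a₃ : ℝ
  a₄ : ℝ
  f : ℝ
  g : ℝ

/-- The conserved shift `λ = a₁ + 2 a₂ + a₃ + a₄ + a₀`. -/
def DPVState.shift (p : DPVState) : ℝ := p.a₁ + 2 * p.a₂ + p.a₃ + p.a₄ + p.a₀

/-- Sakai's difference Painlevé V equation `d-P_V` with the additional parameter `t`: one step from
the state `p` to the state `q`, in particular with no vanishing denominators. -/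
structure IsDPVStep (t : ℝ) (p q : DPVState) : Prop where
  a₀_eq : q.a₀ = p.a₀ + p.shift
  a₁_eq : q.a₁ = p.a₁ + p.shift
  a₂_eq : q.a₂ = p.a₂ - p.shift
  a₃_eq : q.a₃ = p.a₃
  a₄_eq : q.a₄ = p.a₄
  den₁_ne : 1 + p.g ≠ 0
  den₂_ne : 1 + t * p.g ≠ 0
  den₃_ne : t * q.f * (q.f - p.a₃) ≠ 0
  f_eq : q.f + p.f = p.a₃ + p.a₁ / (1 + p.g) + p.a₀ / (1 + t * p.g)
  g_eq : q.g * p.g =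
    (q.f + p.a₂ - p.shift) * (q.f + p.a₂ - p.shift + p.a₄) / (t * q.f * (q.f - p.a₃))

/-- The state of `d-P_V` at time `s` for the Meixner weight. -/
noncomputable def meixnerDPVState (k : ℕ) (β : ℝ) (f g : ℕ → ℝ) (s : ℕ) : DPVState where
  a₀ := β + s
  a₁ := s
  a₂ := -s
  a₃ := -(k + β - 1)
  a₄ := k
  f := f s
  g := g s

/-! ### Fredholm determinants of finite-rank kernels on a discrete set. -/

section Fredholm

open Finset Matrix Filter Topology

/-! Put k = m + 1. The kernel is the orthogonal projection onto the span of √w P_0, …, √w P_m, so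
its Fredholm determinant is a k × k determinant. By orthonormality, 1 minus the Gram matrix over {s,
s+1, …} is the Gram matrix over {0, …, s-1}. Hence D_s is, up to a product of norms, the Hankel
determinant of the weight truncated to s nodes (`meixnerD_eq_det`). It is positive for s ≥ k, and
adding a node is a rank-one update: D_{s+1}/D_s = 1 + w(s) K_s(s,s), with K_s the reproducing kernel
of the truncated weight.

Everything else concerns the monic orthogonal polynomials p, q of degrees m + 1, m for the truncated
weights ("levels"), through the ratios t_z = p(z)/q(z) and the norm N of q. The sequences e, f, g, h
are explicit in these data.

Consecutive levels are linked by two Christoffel transforms. Multiplying the weight by x - s deletes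
the node s. Multiplying it by x deletes the node 0 and, by the Pearson equation, becomes after a
shift c(x + β) times the lower level. Since L((X - z)u²) = -t_z N for the transformed polynomial u,
this relates t_s and t_0 at level s + 1 to t_s and t_{-β} at level s (`seqG_eq_lower`,
`seqE_eq_lower`).

Within a level, summation by parts against the Pearson equation gives quadratic relations between
values of the reproducing kernel (`kernel_kernel`, `kernel_zero`, `kernel_neg_beta`). They yield
`seqF_succ_identities`, and the recurrences and `gap_ratio_difference` follow by elimination.

No denominator vanishes because 0, -β, s, s + 1 lie weakly to one side of the nodes, which fixes the
sign of L((X - z)u²) and hence of t_z. At s = k there are as many nodes as the rank, and finite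
differences give the initial values. -/

theorem Matrix.det_one_add_eq_sum_minors {n R : Type*} [Fintype n] [DecidableEq n] [CommRing R]
    (M : Matrix n n R) :
    (1 + M).det = ∑ S : Finset n, (M.submatrix (Subtype.val : S → n) (Subtype.val : S → n)).det := by
  rw [add_comm]
  -- Multilinearity in the rows: on S the row of `M` is chosen, off S that of the identity.
  have h := (detRowAlternating : (n → R) [⋀^n]→ₗ[R] R).map_add_univ M.row (1 : Matrix n n R).row
  refine h.trans (Finset.sum_congr rfl fun S _ => ?_)
  rw [← det_piecewise_one_eq_submatrix_det]
  rfl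

theorem sum_powerset_fredholmTerm {ι : Type*} [DecidableEq ι] (K : ι → ι → ℝ) (T : Finset ι) :
    ∑ S ∈ T.powerset, fredholmTerm K S = (1 - Matrix.of fun i j : T => K i j).det := by
  rw [sub_eq_add_neg, Matrix.det_one_add_eq_sum_minors]
  symm
  refine Finset.sum_bij (fun S _ => S.map (Function.Embedding.subtype _)) ?_ ?_ ?_ ?_
  · intro S _
    rw [mem_powerset]
    intro x hx
    obtain ⟨y, _, rfl⟩ := Finset.mem_map.1 hx
    exact y.2
  · intro S _ S' _ h
    exact Finset.map_injective _ h
  · intro S hS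
    refine ⟨S.subtype (· ∈ T), mem_univ _, ?_⟩
    exact Finset.subtype_map_of_mem (fun x hx => mem_powerset.1 hS hx)
  · intro S _
    unfold fredholmTerm
    rw [Finset.card_map]
    let e : S ≃ (S.map (Function.Embedding.subtype _) : Finset ι) :=
      Equiv.ofBijective (fun x => ⟨x.1.1, Finset.mem_map_of_mem (Function.Embedding.subtype _) x.2⟩)
        ⟨fun x y h => by
          have h' := congrArg
            (fun z : {a // a ∈ S.map (Function.Embedding.subtype (· ∈ T))} => z.1) h
          exact Subtype.ext (Subtype.ext h'), fun y => by
          obtain ⟨x, hx, hxy⟩ := Finset.mem_map.1 y.2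
          exact ⟨⟨x, hx⟩, Subtype.ext hxy⟩⟩
    rw [← Matrix.det_submatrix_equiv_self e (Matrix.of fun i j => K i j)]
    have : ((-Matrix.of fun i j : T => K i j).submatrix (Subtype.val : S → T) Subtype.val) =
      -((Matrix.of fun i j : (S.map (Function.Embedding.subtype _) : Finset ι) =>
        K i j).submatrix e e) := by
      ext i j
      rfl
    rw [this, Matrix.det_neg, Fintype.card_coe]

variable {ι : Type*} [DecidableEq ι] {κ : Type*} [Fintype κ]

/-- The sign `(-1) ^ S.card` cancels the one from the negated kernel, leaving a Gram determinant. -/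
theorem fredholmTerm_neg_finiteRank_nonneg (Φ : ι → κ → ℝ) (S : Finset ι) :
    0 ≤ fredholmTerm (fun x y => -∑ i, Φ x i * Φ y i) S := by
  unfold fredholmTerm
  have : (Matrix.of fun x y : S => -∑ i, Φ x i * Φ y i) =
      -((Matrix.of fun (x : S) i => Φ x i) * (Matrix.of fun (x : S) i => Φ x i)ᴴ) := by
    ext x y
    simp [Matrix.mul_apply]
  rw [this, Matrix.det_neg, Fintype.card_coe, ← mul_assoc, ← mul_pow]
  simpa using (Matrix.posSemidef_self_mul_conjTranspose (Matrix.of fun (x : S) i => Φ x i)).det_nonneg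

theorem fredholmTerm_eq_neg (K : ι → ι → ℝ) (S : Finset ι) :
    fredholmTerm K S = (-1) ^ S.card * fredholmTerm (fun x y => -K x y) S := by
  unfold fredholmTerm
  have : (Matrix.of fun x y : S => -K x y) = -(Matrix.of fun x y : S => K x y) := rfl
  rw [this, Matrix.det_neg, Fintype.card_coe, ← mul_assoc ((-1 : ℝ) ^ S.card) ((-1) ^ S.card),
    ← mul_pow]
  simp

/-- Since det(1 - AB) = det(1 - BA), the size of the determinant becomes independent of `T`, so that
a limit in `T` can be taken entrywise. The values ε = 1 and ε = -1 serve the value and the absolute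
convergence respectively. -/
theorem sum_powerset_fredholmTerm_finiteRank [DecidableEq κ] (Φ : ι → κ → ℝ) (ε : ℝ) (T : Finset ι) :
    ∑ S ∈ T.powerset, fredholmTerm (fun x y => ε * ∑ i, Φ x i * Φ y i) S =
      (1 - ε • Matrix.of fun i j => ∑ x ∈ T, Φ x i * Φ x j).det := by
  rw [sum_powerset_fredholmTerm]
  have h1 : (Matrix.of fun x y : T => ε * ∑ i, Φ x i * Φ y i) =
      (ε • Matrix.of fun (x : T) i => Φ x i) * (Matrix.of fun (x : T) i => Φ x i)ᵀ := by
    ext x y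
    simp [Matrix.mul_apply, Finset.mul_sum, mul_assoc]
  rw [h1, Matrix.det_one_sub_mul_comm]
  congr 2
  ext i j
  simp only [Matrix.smul_apply, Matrix.mul_apply, Matrix.transpose_apply, Matrix.of_apply,
    smul_eq_mul]
  rw [← Finset.sum_coe_sort T (fun x => Φ x i * Φ x j), Finset.mul_sum]
  exact Finset.sum_congr rfl fun x _ => mul_left_comm _ _ _

theorem tendsto_sum_powerset_fredholmTerm_finiteRank [DecidableEq κ] (Φ : ι → κ → ℝ)
    (hΦ : ∀ i j, Summable fun x => Φ x i * Φ x j) (ε : ℝ) :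
    Tendsto (fun T : Finset ι => ∑ S ∈ T.powerset, fredholmTerm (fun x y => ε * ∑ i, Φ x i * Φ y i) S)
      atTop (𝓝 (1 - ε • Matrix.of fun i j => ∑' x, Φ x i * Φ x j).det) := by
  simp_rw [sum_powerset_fredholmTerm_finiteRank]
  have hc : Continuous fun A : Matrix κ κ ℝ => (1 - ε • A).det := by fun_prop
  refine (hc.tendsto _).comp ?_
  refine tendsto_pi_nhds.2 fun i => tendsto_pi_nhds.2 fun j => ?_
  exact (hΦ i j).hasSum

/-- The terms for -K are the absolute values of those for K. Being nonnegative, they have increasing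
sums over powersets, bounded by the limit det(1 + Gram). -/
theorem summable_fredholmTerm_finiteRank [DecidableEq κ] (Φ : ι → κ → ℝ)
    (hΦ : ∀ i j, Summable fun x => Φ x i * Φ x j) :
    Summable (fredholmTerm fun x y => ∑ i, Φ x i * Φ y i) := by
  have hnn := fredholmTerm_neg_finiteRank_nonneg Φ
  have hneg : Summable (fredholmTerm fun x y => -∑ i, Φ x i * Φ y i) := by
    have ht := tendsto_sum_powerset_fredholmTerm_finiteRank Φ hΦ (-1)
    simp only [neg_one_mul] at ht
    refine summable_of_sum_le hnn (c := (1 - (-1 : ℝ) • Matrix.of fun i j => ∑' x, Φ x i * Φ x j).det)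
      fun 𝒮 => ?_
    -- Any finite family of finite sets lies in the powerset of its union.
    have hsub : 𝒮 ⊆ (𝒮.sup id).powerset := fun S hS =>
      mem_powerset.2 (Finset.le_sup (f := id) hS)
    refine (Finset.sum_le_sum_of_subset_of_nonneg hsub fun S _ _ => hnn S).trans ?_
    refine Monotone.ge_of_tendsto ?_ ht _
    intro T T' h
    exact Finset.sum_le_sum_of_subset_of_nonneg (powerset_mono.2 h) fun S _ _ => hnn S
  refine Summable.of_norm_bounded hneg fun S => ?_
  rw [fredholmTerm_eq_neg, norm_mul, norm_pow, norm_neg, norm_one, one_pow, one_mul,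
    Real.norm_of_nonneg (hnn S)]

/-- A summable family may be summed along the cofinal net of powersets, where the limit is known. -/
theorem fredholmDet_finiteRank [DecidableEq κ] (Φ : ι → κ → ℝ)
    (hΦ : ∀ i j, Summable fun x => Φ x i * Φ x j) :
    fredholmDet (fun x y => ∑ i, Φ x i * Φ y i) =
      (1 - Matrix.of fun i j => ∑' x, Φ x i * Φ x j).det := by
  have h1 := (summable_fredholmTerm_finiteRank Φ hΦ).hasSum.comp
    (tendsto_finset_powerset_atTop_atTop (α := ι))
  have h2 := tendsto_sum_powerset_fredholmTerm_finiteRank Φ hΦ 1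
  simp only [one_mul, one_smul] at h2
  exact tendsto_nhds_unique h1 h2

end Fredholm

/-! ### Orthogonal polynomials and reproducing kernels of a moment functional. -/

section OrthogonalPolynomials

open Polynomial Matrix

/-- The quadratic form of the moment functional `L` is anisotropic in degrees `< k`. -/
def MomentDefinite (L : ℝ[X] →ₗ[ℝ] ℝ) (k : ℕ) : Prop :=
  ∀ r : ℝ[X], r.degree < k → L (r * r) = 0 → r = 0

/-- `p` is the monic orthogonal polynomial of degree `j` for the moment functional `L`. -/
structure IsMonicOP (L : ℝ[X] →ₗ[ℝ] ℝ) (j : ℕ) (p : ℝ[X]) : Prop where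
  monic : p.Monic
  natDegree_eq : p.natDegree = j
  orth : ∀ f : ℝ[X], f.degree < j → L (p * f) = 0

/-- `K` is the reproducing kernel of the polynomials of degree `< k` for `L`. -/
structure IsReproducing (L : ℝ[X] →ₗ[ℝ] ℝ) (k : ℕ) (K : ℝ → ℝ[X]) : Prop where
  degree_lt : ∀ z, (K z).degree < k
  repr : ∀ z (f : ℝ[X]), f.degree < k → L (K z * f) = f.eval z

variable {L : ℝ[X] →ₗ[ℝ] ℝ}

theorem MomentDefinite.mono {j k : ℕ} (h : MomentDefinite L k) (hjk : j ≤ k) :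
    MomentDefinite L j :=
  fun r hr => h r (hr.trans_le (by exact_mod_cast hjk))

theorem degree_sub_smul_lt {j : ℕ} {p f : ℝ[X]} (hp : p.Monic) (hj : p.natDegree = j)
    (hf : f.degree < (j + 1 : ℕ)) : (f - C (f.coeff j) * p).degree < j := by
  rw [degree_lt_iff_coeff_zero]
  intro i hi
  rw [coeff_sub, coeff_C_mul]
  rcases hi.eq_or_lt with rfl | hi
  · have : p.coeff j = 1 := by rw [← hj]; exact hp
    rw [this]; ring
  · rw [(degree_lt_iff_coeff_zero f _).1 hf i hi, coeff_eq_zero_of_natDegree_lt (p := p) (by omega)]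
    ring

theorem map_C_mul (L : ℝ[X] →ₗ[ℝ] ℝ) (a : ℝ) (p : ℝ[X]) : L (C a * p) = a * L p := by
  rw [← smul_eq_C_mul, map_smul, smul_eq_mul]

namespace IsMonicOP

variable {j : ℕ} {p : ℝ[X]}

theorem degree_eq (h : IsMonicOP L j p) : p.degree = j := by
  rw [degree_eq_natDegree h.monic.ne_zero, h.natDegree_eq]

theorem degree_lt (h : IsMonicOP L j p) : p.degree < (j + 1 : ℕ) := by
  rw [h.degree_eq]; exact_mod_cast j.lt_succ_self

theorem coeff_self (h : IsMonicOP L j p) : p.coeff j = 1 := by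
  have := h.monic
  rwa [Monic, leadingCoeff, h.natDegree_eq] at this

theorem map_mul (h : IsMonicOP L j p) {f : ℝ[X]} (hf : f.degree < (j + 1 : ℕ)) :
    L (p * f) = f.coeff j * L (p * p) := by
  have h0 := h.orth _ (degree_sub_smul_lt h.monic h.natDegree_eq hf)
  rw [mul_sub, map_sub, mul_left_comm, map_C_mul] at h0
  linarith

theorem unique (hL : MomentDefinite L j) (h : IsMonicOP L j p) {p' : ℝ[X]}
    (h' : IsMonicOP L j p') : p = p' := by
  have hd : (p - p').degree < j := by
    have := degree_sub_smul_lt h'.monic h'.natDegree_eq h.degree_lt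
    rwa [h.coeff_self, C_1, one_mul] at this
  refine sub_eq_zero.1 (hL _ hd ?_)
  rw [sub_mul, map_sub, h.orth _ hd, h'.orth _ hd, sub_zero]

theorem norm_ne_zero (h : IsMonicOP L j p) (hL : MomentDefinite L (j + 1)) : L (p * p) ≠ 0 :=
  fun h0 => h.monic.ne_zero (hL p h.degree_lt h0)

end IsMonicOP

namespace IsReproducing

variable {k : ℕ} {K : ℝ → ℝ[X]}

theorem eq_of_repr (h : IsReproducing L k K) (hL : MomentDefinite L k) {z : ℝ} {r : ℝ[X]}
    (hr : r.degree < k) (hr' : ∀ f : ℝ[X], f.degree < k → L (r * f) = f.eval z) : r = K z := by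
  have hd : (r - K z).degree < k := (degree_sub_le _ _).trans_lt (max_lt hr (h.degree_lt z))
  refine sub_eq_zero.1 (hL _ hd ?_)
  rw [sub_mul, map_sub, h.repr z _ hd, hr' _ hd, sub_self]

variable {m : ℕ} {p q : ℝ[X]}

/-- Pairing `K z` with `q` can be read in two ways: reproduction gives q(z), orthogonality leaves
the top coefficient of `K z`. -/
theorem norm_mul_coeff (h : IsReproducing L (m + 1) K) (hq : IsMonicOP L m q) (z : ℝ) :
    L (q * q) * (K z).coeff m = q.eval z := by
  rw [← h.repr z q hq.degree_lt, mul_comm (K z), hq.map_mul (h.degree_lt z), mul_comm]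

/-- The Christoffel–Darboux identity. -/
theorem christoffel_darboux (h : IsReproducing L (m + 1) K) (hL : MomentDefinite L (m + 1))
    (hp : IsMonicOP L (m + 1) p) (hq : IsMonicOP L m q) (z : ℝ) :
    C (L (q * q)) * ((X - C z) * K z) = C (q.eval z) * p - C (p.eval z) * q := by
  have hcoeff : ∀ f : ℝ[X], f.degree < (m + 1 : ℕ) →
      ((X - C z) * f : ℝ[X]).degree < (m + 1 + 1 : ℕ) ∧ ((X - C z) * f).coeff (m + 1) = f.coeff m := by
    intro f hf
    have h1 : ∀ i, ((X - C z) * f).coeff (i + 1) = f.coeff i - z * f.coeff (i + 1) := fun i => by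
      rw [sub_mul, coeff_sub, coeff_X_mul, coeff_C_mul]
    have h2 := (degree_lt_iff_coeff_zero f _).1 hf
    refine ⟨(degree_lt_iff_coeff_zero _ _).2 fun i hi => ?_, ?_⟩
    · obtain ⟨i, rfl⟩ : ∃ i', i = i' + 1 := ⟨i - 1, by omega⟩
      rw [h1, h2 i (by omega), h2 (i + 1) (by omega)]; ring
    · rw [h1, h2 (m + 1) le_rfl]; ring
  set N := L (q * q) with hN
  -- The difference `r` of the two sides has degree at most m, because `norm_mul_coeff` cancels the
  -- leading terms. It is also orthogonal to all polynomials of degree at most m, so it vanishes by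
  -- definiteness.
  set r := C N * ((X - C z) * K z) - C (q.eval z) * p + C (p.eval z) * q with hr
  have hrd : r.degree < (m + 1 : ℕ) := by
    have h1 := degree_sub_smul_lt hp.monic hp.natDegree_eq (hcoeff _ (h.degree_lt z)).1
    rw [(hcoeff _ (h.degree_lt z)).2] at h1
    have h2 : r = C N * ((X - C z) * K z - C ((K z).coeff m) * p) + C (p.eval z) * q := by
      rw [hr, ← h.norm_mul_coeff hq z, C_mul]; ring
    rw [h2]
    refine (degree_add_le _ _).trans_lt (max_lt ?_ ?_)
    · rw [← smul_eq_C_mul]; exact (degree_smul_le _ _).trans_lt h1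
    · rw [← smul_eq_C_mul]; exact (degree_smul_le _ _).trans_lt hq.degree_lt
  have hr0 : ∀ f : ℝ[X], f.degree < (m + 1 : ℕ) → L (r * f) = 0 := by
    intro f hf
    have h1 := degree_sub_smul_lt hp.monic hp.natDegree_eq (hcoeff _ hf).1
    rw [(hcoeff _ hf).2] at h1
    -- The product (X - z)f may have degree m + 1, outside the range of reproduction; a multiple of
    -- `p`, which is orthogonal to `K z`, is subtracted first.
    have h2 : L (K z * ((X - C z) * f)) = -(f.coeff m * p.eval z) := by
      have h3 := h.repr z _ h1
      rw [mul_sub, map_sub, mul_left_comm _ (C _), map_C_mul, mul_comm (K z) p,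
        hp.orth _ (h.degree_lt z)] at h3
      simp only [eval_sub, eval_mul, eval_X, eval_C] at h3
      linarith
    have h4 : r * f = C N * (K z * ((X - C z) * f)) - C (q.eval z) * (p * f)
        + C (p.eval z) * (q * f) := by rw [hr]; ring
    rw [h4, map_add, map_sub, map_C_mul, map_C_mul, map_C_mul, h2, hp.orth f hf, hq.map_mul hf]
    ring
  have := hL r hrd (hr0 r hrd)
  rw [hr] at this
  linear_combination this

theorem christoffel_darboux_eval (h : IsReproducing L (m + 1) K) (hL : MomentDefinite L (m + 1))
    (hp : IsMonicOP L (m + 1) p) (hq : IsMonicOP L m q) (x z : ℝ) :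
    L (q * q) * ((x - z) * (K z).eval x) = q.eval z * p.eval x - p.eval z * q.eval x := by
  have := congrArg (eval x) (h.christoffel_darboux hL hp hq z)
  simpa using this

/-- The Christoffel–Darboux identity is differentiated in x and evaluated at x = z. -/
theorem christoffel_darboux_diag (h : IsReproducing L (m + 1) K) (hL : MomentDefinite L (m + 1))
    (hp : IsMonicOP L (m + 1) p) (hq : IsMonicOP L m q) (z : ℝ) :
    L (q * q) * (K z).eval z =
      p.derivative.eval z * q.eval z - q.derivative.eval z * p.eval z := by
  have := congrArg (fun r => eval z (derivative r)) (h.christoffel_darboux hL hp hq z)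
  simp at this
  linear_combination this

end IsReproducing

/-- The Gram matrix of the monomials of degree `< k`. -/
noncomputable def momentMatrix (L : ℝ[X] →ₗ[ℝ] ℝ) (k : ℕ) : Matrix (Fin k) (Fin k) ℝ :=
  Matrix.of fun i j => L (X ^ ((i : ℕ) + j))

/-- The polynomial of degree `< k` with the given coefficients. -/
noncomputable def polyOfVec {k : ℕ} (v : Fin k → ℝ) : ℝ[X] := ∑ i, C (v i) * X ^ (i : ℕ)

theorem degree_polyOfVec_lt {k : ℕ} (v : Fin k → ℝ) : (polyOfVec v).degree < k := by
  refine (degree_sum_le _ _).trans_lt ((Finset.sup_lt_iff (WithBot.bot_lt_coe k)).2 fun i _ => ?_)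
  exact (degree_C_mul_X_pow_le _ _).trans_lt (Nat.cast_lt.2 i.2)

theorem coeff_polyOfVec {k : ℕ} (v : Fin k → ℝ) (i : Fin k) : (polyOfVec v).coeff i = v i := by
  rw [polyOfVec, finsetSum_coeff, Finset.sum_eq_single i]
  · simp
  · intro j _ hj
    rw [coeff_C_mul, coeff_X_pow, if_neg fun h => hj (Fin.ext h.symm), mul_zero]
  · simp

theorem polyOfVec_coeff {k : ℕ} {f : ℝ[X]} (hf : f.degree < k) :
    polyOfVec (fun i : Fin k => f.coeff i) = f := by
  ext i
  by_cases hi : i < k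
  · exact coeff_polyOfVec _ ⟨i, hi⟩
  · rw [(degree_lt_iff_coeff_zero _ _).1 (degree_polyOfVec_lt _) i (by omega),
      (degree_lt_iff_coeff_zero _ _).1 hf i (by omega)]

theorem map_polyOfVec (ℓ : ℝ[X] →ₗ[ℝ] ℝ) {k : ℕ} (v : Fin k → ℝ) :
    ℓ (polyOfVec v) = v ⬝ᵥ fun i => ℓ (X ^ (i : ℕ)) := by
  simp [polyOfVec, map_sum, map_C_mul, dotProduct]

theorem map_polyOfVec_mul {k : ℕ} (v w : Fin k → ℝ) :
    L (polyOfVec v * polyOfVec w) = w ⬝ᵥ (momentMatrix L k *ᵥ v) := by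
  simp only [polyOfVec, dotProduct, mulVec, momentMatrix, of_apply]
  simp only [Finset.sum_mul, Finset.mul_sum, map_sum]
  refine Finset.sum_congr rfl fun i _ => Finset.sum_congr rfl fun j _ => ?_
  have : C (v j) * X ^ (j : ℕ) * (C (w i) * X ^ (i : ℕ)) =
      C (v j * w i) * X ^ ((i : ℕ) + j) := by
    rw [C_mul, pow_add]; ring
  rw [this, map_C_mul]; ring

theorem momentMatrix_det_ne_zero {k : ℕ} (hL : MomentDefinite L k) : (momentMatrix L k).det ≠ 0 := by
  intro h
  obtain ⟨v, hv, h0⟩ := exists_mulVec_eq_zero_iff.2 h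
  refine hv (funext fun i => ?_)
  have := hL _ (degree_polyOfVec_lt v) (by rw [map_polyOfVec_mul, h0, dotProduct_zero])
  rw [← coeff_polyOfVec v i, this]; simp

/-- Riesz representation of a functional on the polynomials of degree `< k`. -/
theorem map_polyOfVec_inv_mul {k : ℕ} (hL : MomentDefinite L k) (ℓ : ℝ[X] →ₗ[ℝ] ℝ) {f : ℝ[X]}
    (hf : f.degree < k) :
    L (polyOfVec ((momentMatrix L k)⁻¹ *ᵥ fun i => ℓ (X ^ (i : ℕ))) * f) = ℓ f := by
  conv_lhs => rw [← polyOfVec_coeff hf]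
  conv_rhs => rw [← polyOfVec_coeff hf]
  rw [map_polyOfVec_mul, map_polyOfVec, mulVec_mulVec,
    mul_nonsing_inv _ (momentMatrix_det_ne_zero hL).isUnit, one_mulVec]

/-- The reproducing kernel built from the inverse of the moment matrix. -/
noncomputable def reprKernel (L : ℝ[X] →ₗ[ℝ] ℝ) (k : ℕ) (z : ℝ) : ℝ[X] :=
  polyOfVec ((momentMatrix L k)⁻¹ *ᵥ fun i => z ^ (i : ℕ))

theorem isReproducing_reprKernel {k : ℕ} (hL : MomentDefinite L k) :
    IsReproducing L k (reprKernel L k) where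
  degree_lt _ := degree_polyOfVec_lt _
  repr z f hf := by
    have := map_polyOfVec_inv_mul hL (leval z) hf
    simpa [reprKernel] using this

theorem eval_reprKernel (k : ℕ) (x z : ℝ) : (reprKernel L k z).eval x =
    (fun i : Fin k => x ^ (i : ℕ)) ⬝ᵥ ((momentMatrix L k)⁻¹ *ᵥ fun i => z ^ (i : ℕ)) := by
  rw [reprKernel]
  have := map_polyOfVec (leval x) ((momentMatrix L k)⁻¹ *ᵥ fun i => z ^ (i : ℕ))
  rw [dotProduct_comm]
  simpa using this

/-- The monic orthogonal polynomial of degree `j`. -/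
noncomputable def monicOP (L : ℝ[X] →ₗ[ℝ] ℝ) (j : ℕ) : ℝ[X] :=
  X ^ j - polyOfVec ((momentMatrix L j)⁻¹ *ᵥ fun i => L (X ^ j * X ^ (i : ℕ)))

theorem isMonicOP_monicOP {j : ℕ} (hL : MomentDefinite L j) : IsMonicOP L j (monicOP L j) where
  monic := monic_X_pow_sub (degree_polyOfVec_lt _)
  natDegree_eq := by
    refine natDegree_eq_of_degree_eq_some ?_
    rw [monicOP, degree_sub_eq_left_of_degree_lt, degree_X_pow]
    rw [degree_X_pow]; exact degree_polyOfVec_lt _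
  orth f hf := by
    have := map_polyOfVec_inv_mul hL (L ∘ₗ LinearMap.mulLeft ℝ (X ^ j)) hf
    simp only [LinearMap.comp_apply, LinearMap.mulLeft_apply] at this
    rw [monicOP, sub_mul, map_sub, this, sub_self]

end OrthogonalPolynomials

/-! ### Positive weights on finitely many nodes, and one-sided positivity. -/

section DiscreteFunctional

open Polynomial

/-- The functional `f ↦ ∑_{x < n} w(x) f(x)`. -/
noncomputable def discreteFunctional (w : ℕ → ℝ) (n : ℕ) : ℝ[X] →ₗ[ℝ] ℝ :=
  ∑ x ∈ Finset.range n, w x • leval (x : ℝ)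

theorem discreteFunctional_apply (w : ℕ → ℝ) (n : ℕ) (f : ℝ[X]) :
    discreteFunctional w n f = ∑ x ∈ Finset.range n, w x * f.eval (x : ℝ) := by
  simp [discreteFunctional, LinearMap.sum_apply]

/-- The functional `f ↦ L ((X - z) f)`. -/
noncomputable def christoffelFunctional (L : ℝ[X] →ₗ[ℝ] ℝ) (z : ℝ) : ℝ[X] →ₗ[ℝ] ℝ :=
  L ∘ₗ LinearMap.mulLeft ℝ (X - C z)

theorem christoffelFunctional_apply (L : ℝ[X] →ₗ[ℝ] ℝ) (z : ℝ) (f : ℝ[X]) :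
    christoffelFunctional L z f = L ((X - C z) * f) := rfl

theorem eq_zero_of_eval_range_eq_zero {r : ℝ[X]} {j : ℕ} (hr : r.degree < j) (S : Finset ℕ)
    (hS : j ≤ S.card) (h : ∀ x ∈ S, r.eval (x : ℝ) = 0) : r = 0 := by
  refine eq_zero_of_degree_lt_of_eval_finset_eq_zero (S.map ⟨Nat.cast, Nat.cast_injective⟩) ?_ ?_
  · rw [Finset.card_map]; exact hr.trans_le (by exact_mod_cast hS)
  · intro x hx
    obtain ⟨y, hy, rfl⟩ := Finset.mem_map.1 hx
    exact h y hy

variable {w : ℕ → ℝ} {n : ℕ}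

theorem momentDefinite_discreteFunctional (hw : ∀ x, 0 < w x) {j : ℕ} (hj : j ≤ n) :
    MomentDefinite (discreteFunctional w n) j := by
  intro r hr h
  rw [discreteFunctional_apply, Finset.sum_eq_zero_iff_of_nonneg fun x _ => by
    rw [eval_mul]; exact mul_nonneg (hw x).le (mul_self_nonneg _)] at h
  refine eq_zero_of_eval_range_eq_zero hr (Finset.range n) (by simpa using hj) fun x hx => ?_
  have := h x hx
  rw [eval_mul] at this
  simpa [(hw x).ne'] using this

theorem discreteFunctional_mul_self_pos (hw : ∀ x, 0 < w x) {r : ℝ[X]} (hr : r ≠ 0)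
    (hrd : r.degree < n) : 0 < discreteFunctional w n (r * r) := by
  refine lt_of_le_of_ne ?_ fun h => hr (momentDefinite_discreteFunctional hw le_rfl r hrd h.symm)
  rw [discreteFunctional_apply]
  exact Finset.sum_nonneg fun x _ => by rw [eval_mul]; exact mul_nonneg (hw x).le (mul_self_nonneg _)

/-- The factor δ = ±1 records the side of the nodes on which z lies. The point z may itself be a
node; it then contributes nothing, and only the remaining nodes have to determine `r`. -/
theorem discreteFunctional_one_sided_pos (hw : ∀ x, 0 < w x) {δ z : ℝ}
    (hδ : ∀ x < n, (x : ℝ) ≠ z → 0 < δ * (x - z)) {r : ℝ[X]} (hr : r ≠ 0) {j : ℕ}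
    (hrd : r.degree < j) (hj : j ≤ ((Finset.range n).filter fun x : ℕ => (x : ℝ) ≠ z).card) :
    0 < δ * christoffelFunctional (discreteFunctional w n) z (r * r) := by
  rw [christoffelFunctional_apply, discreteFunctional_apply, Finset.mul_sum]
  have hterm : ∀ x ∈ Finset.range n, δ * (w x * ((X - C z) * (r * r)).eval (x : ℝ)) =
      w x * (δ * (x - z) * (r.eval (x : ℝ) * r.eval (x : ℝ))) := fun x _ => by
    simp only [eval_mul, eval_sub, eval_X, eval_C]; ring
  rw [Finset.sum_congr rfl hterm]
  have hnn : ∀ x ∈ Finset.range n,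
      0 ≤ w x * (δ * (x - z) * (r.eval (x : ℝ) * r.eval (x : ℝ))) := fun x hx => by
    by_cases hxz : (x : ℝ) = z
    · simp [hxz]
    · exact mul_nonneg (hw x).le
        (mul_nonneg (hδ x (Finset.mem_range.1 hx) hxz).le (mul_self_nonneg _))
  refine lt_of_le_of_ne (Finset.sum_nonneg hnn) fun h => hr ?_
  have h0 := (Finset.sum_eq_zero_iff_of_nonneg hnn).1 h.symm
  refine eq_zero_of_eval_range_eq_zero hrd _ hj fun x hx => ?_
  obtain ⟨hx, hxz⟩ := Finset.mem_filter.1 hx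
  have h1 := hδ x (Finset.mem_range.1 hx) hxz
  have h2 := h0 x hx
  simpa [(hw x).ne', h1.ne'] using h2

theorem le_card_filter_ne (n : ℕ) (z : ℝ) :
    n - 1 ≤ ((Finset.range n).filter fun x : ℕ => (x : ℝ) ≠ z).card := by
  by_cases hz : ∃ y : ℕ, (y : ℝ) = z
  · obtain ⟨y, rfl⟩ := hz
    have : ((Finset.range n).filter fun x : ℕ => (x : ℝ) ≠ y) = (Finset.range n).erase y := by
      ext x; simp [and_comm]
    rw [this]
    have := Finset.pred_card_le_card_erase (s := Finset.range n) (a := y)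
    simpa using this
  · push Not at hz
    rw [Finset.filter_true_of_mem fun x _ => hz x]
    simp

/-- Orthogonal polynomials do not vanish at points not between the nodes. -/
theorem IsMonicOP.eval_ne_zero_of_one_sided (hw : ∀ x, 0 < w x) {δ z : ℝ}
    (hδ : ∀ x < n, (x : ℝ) ≠ z → 0 < δ * (x - z)) {m : ℕ} (hmn : m + 1 ≤ n) {q : ℝ[X]}
    (hq : IsMonicOP (discreteFunctional w n) m q) : q.eval z ≠ 0 := by
  intro h
  obtain ⟨r, hr⟩ := dvd_iff_isRoot.2 h
  have hr0 : r ≠ 0 := by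
    rintro rfl
    exact hq.monic.ne_zero (by simpa using hr)
  have hd : r.degree < m := by
    have h1 := hq.natDegree_eq
    rw [hr, natDegree_mul (X_sub_C_ne_zero z) hr0, natDegree_X_sub_C] at h1
    rw [degree_eq_natDegree hr0]
    exact_mod_cast (by omega : r.natDegree < m)
  -- If q = (X - z)r, then L((X - z)r²) = L(q r) = 0 by orthogonality, against one-sided positivity.
  have hpos := discreteFunctional_one_sided_pos hw hδ hr0 hd
    ((by omega : m ≤ n - 1).trans (le_card_filter_ne n z))
  rw [christoffelFunctional_apply, ← mul_assoc, ← hr, hq.orth r hd, mul_zero] at hpos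
  exact lt_irrefl _ hpos

end DiscreteFunctional

/-! ### The Christoffel transform L ↦ L((X - z) · ). -/

section ChristoffelTransform

open Polynomial

variable {L : ℝ[X] →ₗ[ℝ] ℝ} {m : ℕ}

/-- `christoffelPoly L m z` is the monic multiple of the reproducing kernel at `z` of the polynomials
of degree at most `m`. -/
noncomputable def christoffelPoly (L : ℝ[X] →ₗ[ℝ] ℝ) (m : ℕ) (z : ℝ) : ℝ[X] :=
  C (L (monicOP L m * monicOP L m) / (monicOP L m).eval z) * reprKernel L (m + 1) z

/-- The quotient of two consecutive monic orthogonal polynomials. -/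
noncomputable def opRatio (L : ℝ[X] →ₗ[ℝ] ℝ) (m : ℕ) (z : ℝ) : ℝ :=
  (monicOP L (m + 1)).eval z / (monicOP L m).eval z

theorem X_sub_C_mul_christoffelPoly (hL : MomentDefinite L (m + 1)) {z : ℝ}
    (hz : (monicOP L m).eval z ≠ 0) : (X - C z) * christoffelPoly L m z =
      monicOP L (m + 1) - C (opRatio L m z) * monicOP L m := by
  have h := (isReproducing_reprKernel hL).christoffel_darboux hL (isMonicOP_monicOP hL)
    (isMonicOP_monicOP (hL.mono m.le_succ)) z
  have hC : C ((monicOP L m).eval z)⁻¹ * C ((monicOP L m).eval z) = 1 := by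
    rw [← C_mul, inv_mul_cancel₀ hz, C_1]
  rw [christoffelPoly, opRatio, div_eq_mul_inv, div_eq_mul_inv, C_mul, C_mul]
  linear_combination C ((monicOP L m).eval z)⁻¹ * h + hC * monicOP L (m + 1)

/-- The product (X - z)u = p - t_z q combines two polynomials that are orthogonal to degrees below
m. -/
theorem isMonicOP_christoffelPoly (hL : MomentDefinite L (m + 1)) {z : ℝ}
    (hz : (monicOP L m).eval z ≠ 0) :
    IsMonicOP (christoffelFunctional L z) m (christoffelPoly L m z) := by
  have hK := isReproducing_reprKernel hL
  have hq := isMonicOP_monicOP (hL.mono m.le_succ)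
  have hp := isMonicOP_monicOP hL
  have hN := hq.norm_ne_zero hL
  have hd : (christoffelPoly L m z).degree < (m + 1 : ℕ) := by
    rw [christoffelPoly, ← smul_eq_C_mul]
    exact (degree_smul_le _ _).trans_lt (hK.degree_lt z)
  have hc : (christoffelPoly L m z).coeff m = 1 := by
    rw [christoffelPoly, coeff_C_mul, div_mul_eq_mul_div, hK.norm_mul_coeff hq, div_self hz]
  have hle : (christoffelPoly L m z).natDegree ≤ m := by
    by_cases h0 : christoffelPoly L m z = 0
    · simp [h0]
    · have := (natDegree_lt_iff_degree_lt h0).2 hd; omega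
  refine ⟨monic_of_natDegree_le_of_coeff_eq_one m hle hc,
    le_antisymm hle (le_natDegree_of_ne_zero (by rw [hc]; exact one_ne_zero)), fun f hf => ?_⟩
  rw [christoffelFunctional_apply, ← mul_assoc, X_sub_C_mul_christoffelPoly hL hz, sub_mul, map_sub,
    hp.orth f (hf.trans (by exact_mod_cast m.lt_succ_self)), mul_assoc, map_C_mul, hq.orth f hf]
  ring

/-- In L((p - t_z q)u) the first part vanishes and the second sees only the leading coefficient of
u. This identity carries both the signs of the ratios and their comparison between levels. -/
theorem christoffelFunctional_christoffelPoly_mul_self (hL : MomentDefinite L (m + 1)) {z : ℝ}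
    (hz : (monicOP L m).eval z ≠ 0) :
    christoffelFunctional L z (christoffelPoly L m z * christoffelPoly L m z) =
      -(opRatio L m z * L (monicOP L m * monicOP L m)) := by
  have hu := isMonicOP_christoffelPoly hL hz
  have hq := isMonicOP_monicOP (hL.mono m.le_succ)
  rw [christoffelFunctional_apply, ← mul_assoc, X_sub_C_mul_christoffelPoly hL hz, sub_mul, map_sub,
    (isMonicOP_monicOP hL).orth _ hu.degree_lt, mul_assoc, map_C_mul, hq.map_mul hu.degree_lt,
    hu.coeff_self]
  ring

theorem IsMonicOP.eq_C_mul {p r : ℝ[X]} {j : ℕ} (hp : IsMonicOP L j p) (hL : MomentDefinite L j)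
    (hr : r.degree < (j + 1 : ℕ)) (horth : ∀ f : ℝ[X], f.degree < j → L (r * f) = 0) :
    r = C (r.coeff j) * p := by
  have hd := degree_sub_smul_lt hp.monic hp.natDegree_eq hr
  refine sub_eq_zero.1 (hL _ hd ?_)
  rw [sub_mul, map_sub, horth _ hd, mul_assoc, map_C_mul, hp.orth _ hd]
  ring

end ChristoffelTransform

/-! ### Pairings of translated orthogonal polynomials. -/

section ShiftIdentities

open Polynomial

theorem degree_comp_X_add_C_lt {r : ℝ[X]} {j : ℕ} (hr : r.degree < j) (a : ℝ) :
    (r.comp (X + C a)).degree < j := by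
  rw [← taylor_apply, degree_taylor]; exact hr

theorem coeff_comp_X_add_C {r : ℝ[X]} {m : ℕ} (hr : r.degree < (m + 1 : ℕ)) (a : ℝ) :
    (r.comp (X + C a)).coeff m = r.coeff m := by
  have hle : r.natDegree ≤ m := by
    by_cases h0 : r = 0
    · simp [h0]
    · have := (natDegree_lt_iff_degree_lt h0).2 hr; omega
  rcases hle.eq_or_lt with h | h
  · rw [← taylor_apply, ← h, coeff_taylor_natDegree]
    rfl
  · rw [coeff_eq_zero_of_natDegree_lt h, coeff_eq_zero_of_natDegree_lt]
    rwa [← taylor_apply, natDegree_taylor]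

variable {L : ℝ[X] →ₗ[ℝ] ℝ} {m : ℕ} {p q : ℝ[X]}

theorem IsMonicOP.map_comp_mul (hq : IsMonicOP L m q) {f : ℝ[X]} (hf : f.degree < (m + 1 : ℕ))
    (a : ℝ) : L (f.comp (X + C a) * q) = f.coeff m * L (q * q) := by
  rw [mul_comm, hq.map_mul (degree_comp_X_add_C_lt hf a), coeff_comp_X_add_C hf]

/-- Translating by a adds (m + 1)a to the coefficient of X^m, and L(p q) = 0. -/
theorem IsMonicOP.map_comp_succ_mul (hp : IsMonicOP L (m + 1) p) (hq : IsMonicOP L m q) (a : ℝ) :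
    L (p.comp (X + C a) * q) = (m + 1) * a * L (q * q) := by
  set r := p - X ^ (m + 1) with hr
  have hrd : r.degree < (m + 1 : ℕ) := by
    have := degree_sub_lt_left (p := p) (q := X ^ (m + 1)) (by rw [hp.degree_eq, degree_X_pow])
      hp.monic.ne_zero (by rw [hp.monic.leadingCoeff, leadingCoeff_X_pow])
    rwa [hp.degree_eq] at this
  set g := ((X + C a) ^ (m + 1) - X ^ (m + 1) : ℝ[X]) with hg
  have hgc : ∀ i, g.coeff i = a ^ (m + 1 - i) * ((m + 1).choose i : ℝ) - if i = m + 1 then 1 else 0 :=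
    fun i => by rw [hg, coeff_sub, coeff_X_add_C_pow, coeff_X_pow]
  have hgd : g.degree < (m + 1 : ℕ) := by
    refine (degree_lt_iff_coeff_zero _ _).2 fun i hi => ?_
    rw [hgc]
    rcases hi.eq_or_lt with rfl | hi
    · simp
    · rw [Nat.choose_eq_zero_of_lt hi, if_neg hi.ne']; simp
  have hdec : p.comp (X + C a) * q = p * q + q * g + (r.comp (X + C a) * q - q * r) := by
    have h1 : p.comp (X + C a) = r.comp (X + C a) + (X + C a) ^ (m + 1) := by
      rw [hr, sub_comp, pow_comp, X_comp]; ring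
    rw [h1, hg, hr]; ring
  rw [hdec, map_add, map_add, map_sub, hp.orth q hq.degree_lt, hq.map_mul hgd, hq.map_mul hrd,
    hq.map_comp_mul hrd, hgc]
  have h2 : m + 1 - m = 1 := by omega
  rw [h2, Nat.choose_succ_self_right, if_neg (by omega)]
  push_cast
  ring

end ShiftIdentities

/-! ### Summation by parts against the Pearson equation. -/

section Pearson

open Polynomial

/-- A positive weight satisfying the Pearson equation of the Meixner weight. -/
structure IsPearsonWeight (β c : ℝ) (w : ℕ → ℝ) : Prop where
  pos : ∀ x, 0 < w x
  pearson : ∀ x : ℕ, (x + 1) * w (x + 1) = c * (β + x) * w x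

variable {β c : ℝ} {w : ℕ → ℝ} {m s : ℕ}

/-- The Pearson equation turns the left side into a sum over the nodes 1, …, s + 1. The node 0 can
be added because of the factor X; the node s + 1, beyond the truncation, gives the boundary term. -/
theorem IsPearsonWeight.summation_by_parts (hw : IsPearsonWeight β c w) (s : ℕ) (f g : ℝ[X]) :
    c * discreteFunctional w (s + 1) ((X + C β) * f.comp (X + C 1) * g) =
      discreteFunctional w (s + 1) (X * f * g.comp (X + C (-1))) +
        (s + 1) * w (s + 1) * f.eval (s + 1 : ℝ) * g.eval (s : ℝ) := by
  rw [discreteFunctional_apply, discreteFunctional_apply, Finset.mul_sum]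
  have h1 : ∀ x ∈ Finset.range (s + 1),
      c * (w x * ((X + C β) * f.comp (X + C 1) * g).eval (x : ℝ)) =
        w (x + 1) * (X * f * g.comp (X + C (-1))).eval ((x + 1 : ℕ) : ℝ) := fun x _ => by
    simp only [eval_mul, eval_add, eval_comp, eval_X, eval_C]
    push_cast
    have h2 : (x : ℝ) + 1 + -1 = x := by ring
    rw [h2]
    linear_combination -(f.eval (x + 1 : ℝ) * g.eval (x : ℝ)) * hw.pearson x
  rw [Finset.sum_congr rfl h1]
  have h3 := Finset.sum_range_succ'
    (fun x : ℕ => w x * (X * f * g.comp (X + C (-1))).eval (x : ℝ)) (s + 1)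
  rw [Finset.sum_range_succ] at h3
  simp only [Nat.cast_zero, eval_mul, eval_X, zero_mul, mul_zero, add_zero] at h3
  simp only [eval_mul, eval_X]
  rw [← h3]
  simp only [eval_comp, eval_add, eval_X, eval_C]
  push_cast
  have h2 : (s : ℝ) + 1 + -1 = s := by ring
  rw [h2]
  ring

variable {p q : ℝ[X]} {K : ℝ → ℝ[X]}

section Kernel

variable {L : ℝ[X] →ₗ[ℝ] ℝ}

theorem IsReproducing.map_X_sub_C_mul (hK : IsReproducing L (m + 1) K)
    (hL : MomentDefinite L (m + 1)) (hp : IsMonicOP L (m + 1) p) (hq : IsMonicOP L m q) (z : ℝ)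
    {f : ℝ[X]} (hf : f.degree < (m + 1 : ℕ)) :
    L ((X - C z) * K z * f) = -(p.eval z * f.coeff m) := by
  have h := congrArg (fun r => L (r * f)) (hK.christoffel_darboux hL hp hq z)
  simp only [sub_mul, map_sub, mul_assoc, map_C_mul, hp.orth f hf, hq.map_mul hf] at h
  refine mul_left_cancel₀ (hq.norm_ne_zero hL) ?_
  rw [sub_mul, sub_mul, map_sub, mul_assoc, mul_assoc, map_C_mul]
  linear_combination h

/-- With X + b = (X - z) + (z + b), the first part is given by Christoffel–Darboux and the second by
reproduction. The coefficient term corrects for the degree raised by X + b. -/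
theorem IsReproducing.map_X_add_C_mul (hK : IsReproducing L (m + 1) K)
    (hL : MomentDefinite L (m + 1)) (hp : IsMonicOP L (m + 1) p) (hq : IsMonicOP L m q) (z b : ℝ)
    {f : ℝ[X]} (hf : f.degree < (m + 1 : ℕ)) :
    L ((X + C b) * K z * f) = (z + b) * f.eval z - p.eval z * f.coeff m := by
  have h1 : (X + C b) * K z * f = (X - C z) * K z * f + C (z + b) * (K z * f) := by
    rw [C_add]; ring
  rw [h1, map_add, map_C_mul, hK.map_X_sub_C_mul hL hp hq z hf, hK.repr z f hf]
  ring

end Kernel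

/-- Summation by parts for the pair K_z, K_y. At (y, z) = (-β, 0) the factors β + y and z vanish; at
(s, s + 1) the kernel values become diagonal ones. -/
theorem IsPearsonWeight.kernel_kernel (hw : IsPearsonWeight β c w) (hms : m ≤ s)
    (hp : IsMonicOP (discreteFunctional w (s + 1)) (m + 1) p)
    (hq : IsMonicOP (discreteFunctional w (s + 1)) m q)
    (hK : IsReproducing (discreteFunctional w (s + 1)) (m + 1) K) (y z : ℝ) :
    c * ((β + y) * (K z).eval (y + 1) - p.eval y * (K z).coeff m) =
      z * (K y).eval (z - 1) - p.eval z * (K y).coeff m +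
        (s + 1) * w (s + 1) * (K z).eval (s + 1 : ℝ) * (K y).eval (s : ℝ) := by
  have hL := momentDefinite_discreteFunctional hw.pos (n := s + 1) (j := m + 1) (by omega)
  have h := hw.summation_by_parts s (K z) (K y)
  have h1 := hK.map_X_add_C_mul hL hp hq y β (degree_comp_X_add_C_lt (hK.degree_lt z) 1)
  have h2 := hK.map_X_add_C_mul hL hp hq z 0 (degree_comp_X_add_C_lt (hK.degree_lt y) (-1))
  rw [coeff_comp_X_add_C (hK.degree_lt _)] at h1 h2
  rw [C_0, add_zero, add_zero] at h2
  rw [mul_right_comm, h1, h2] at h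
  simp only [eval_comp, eval_add, eval_X, eval_C] at h
  rw [sub_eq_add_neg z 1]
  linear_combination h

/-- Summation by parts for the pair K_0, q. The choice z = 0 makes X K_0 a combination of p and q,
also after translation, so that only the shift pairings are needed. At -β the factor X + β plays the
same role. -/
theorem IsPearsonWeight.kernel_zero (hw : IsPearsonWeight β c w) (hms : m ≤ s)
    (hp : IsMonicOP (discreteFunctional w (s + 1)) (m + 1) p)
    (hq : IsMonicOP (discreteFunctional w (s + 1)) m q)
    (hK : IsReproducing (discreteFunctional w (s + 1)) (m + 1) K) :
    (1 - c) * p.eval 0 + c * (β + m) * q.eval 0 =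
      (s + 1) * w (s + 1) * q.eval (s : ℝ) * (K 0).eval (s + 1 : ℝ) := by
  have hL := momentDefinite_discreteFunctional hw.pos (n := s + 1) (j := m + 1) (by omega)
  have h := hw.summation_by_parts s (K 0) q
  have h2 := hK.map_X_add_C_mul hL hp hq 0 0 (degree_comp_X_add_C_lt hq.degree_lt (-1))
  rw [coeff_comp_X_add_C hq.degree_lt, hq.coeff_self, C_0, add_zero] at h2
  have hN := hq.norm_ne_zero hL
  have hcd := congrArg (fun r => r.comp (X + C 1) * q) (hK.christoffel_darboux hL hp hq 0)
  have h3 := congrArg (discreteFunctional w (s + 1)) hcd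
  simp only [C_0, sub_zero, mul_comp, sub_comp, C_comp, X_comp, sub_mul, map_sub, mul_assoc,
    map_C_mul, hp.map_comp_succ_mul hq, hq.map_comp_mul hq.degree_lt, hq.coeff_self] at h3
  have h4 : (X + C β) * (K 0).comp (X + C 1) * q =
      (X + C 1) * ((K 0).comp (X + C 1) * q) + C (β - 1) * ((K 0).comp (X + C 1) * q) := by
    rw [C_sub]; ring
  rw [h4, map_add, map_C_mul, hq.map_comp_mul (hK.degree_lt 0), h2] at h
  have h5 := hK.norm_mul_coeff hq 0
  have h6 := mul_left_cancel₀ hN (h3.trans (by ring :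
    _ = discreteFunctional w (s + 1) (q * q) * ((m + 1) * q.eval 0 - p.eval 0)))
  rw [h6, mul_comm ((K 0).coeff m), h5] at h
  linear_combination h

theorem IsPearsonWeight.kernel_neg_beta (hw : IsPearsonWeight β c w) (hms : m ≤ s)
    (hp : IsMonicOP (discreteFunctional w (s + 1)) (m + 1) p)
    (hq : IsMonicOP (discreteFunctional w (s + 1)) m q)
    (hK : IsReproducing (discreteFunctional w (s + 1)) (m + 1) K) :
    (1 - c) * p.eval (-β) + (β + m) * q.eval (-β) =
      (s + 1) * w (s + 1) * q.eval (s + 1 : ℝ) * (K (-β)).eval (s : ℝ) := by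
  have hL := momentDefinite_discreteFunctional hw.pos (n := s + 1) (j := m + 1) (by omega)
  have h := hw.summation_by_parts s q (K (-β))
  have h2 := hK.map_X_add_C_mul hL hp hq (-β) β (degree_comp_X_add_C_lt hq.degree_lt 1)
  rw [coeff_comp_X_add_C hq.degree_lt, hq.coeff_self] at h2
  have hN := hq.norm_ne_zero hL
  have hcd := congrArg (fun r => r.comp (X + C (-1)) * q) (hK.christoffel_darboux hL hp hq (-β))
  have h3 := congrArg (discreteFunctional w (s + 1)) hcd
  simp only [C_neg, sub_neg_eq_add, mul_comp, sub_comp, add_comp, C_comp, X_comp, sub_mul, map_sub,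
    mul_assoc, map_C_mul] at h3
  rw [← C_neg, hp.map_comp_succ_mul hq, hq.map_comp_mul hq.degree_lt, hq.coeff_self] at h3
  have h4 : X * q * (K (-β)).comp (X + C (-1)) =
      (X + C (-1) + C β) * ((K (-β)).comp (X + C (-1)) * q) +
        C (1 - β) * ((K (-β)).comp (X + C (-1)) * q) := by
    rw [C_sub, C_neg]; ring
  rw [h4, map_add, map_C_mul, hq.map_comp_mul (hK.degree_lt _), mul_right_comm, h2] at h
  have h5 := hK.norm_mul_coeff hq (-β)
  have h6 := mul_left_cancel₀ hN (h3.trans (by ring :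
    _ = discreteFunctional w (s + 1) (q * q) * (-((m + 1) * q.eval (-β)) - p.eval (-β))))
  rw [h6, mul_comm ((K (-β)).coeff m), h5] at h
  linear_combination h

end Pearson

/-! ### Signs of the ratios, and passage from s to s + 1 nodes. -/

section LevelChange

open Polynomial

variable {w : ℕ → ℝ} {m n s : ℕ} {z : ℝ}

theorem one_sided_left (hz : z ≤ 0) (x : ℕ) (_ : x < n) (hxz : (x : ℝ) ≠ z) :
    0 < (1 : ℝ) * (x - z) := by
  have h1 : (0 : ℝ) ≤ x := Nat.cast_nonneg x
  rw [one_mul, sub_pos]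
  exact lt_of_le_of_ne (hz.trans h1) hxz.symm

theorem one_sided_right (hz : (n : ℝ) ≤ z + 1) (x : ℕ) (hx : x < n) (hxz : (x : ℝ) ≠ z) :
    0 < (-1 : ℝ) * (x - z) := by
  have h1 : (x : ℝ) + 1 ≤ n := by exact_mod_cast hx
  have : (x : ℝ) < z := lt_of_le_of_ne (by linarith) hxz
  linarith

theorem card_filter_ne_of_neg (n : ℕ) (hz : z < 0) :
    ((Finset.range n).filter fun x : ℕ => (x : ℝ) ≠ z).card = n := by
  rw [Finset.filter_true_of_mem, Finset.card_range]
  intro x _ h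
  have h1 : (0 : ℝ) ≤ x := Nat.cast_nonneg x
  linarith

theorem card_filter_ne_of_le (hz : (n : ℝ) ≤ z) :
    ((Finset.range n).filter fun x : ℕ => (x : ℝ) ≠ z).card = n := by
  rw [Finset.filter_true_of_mem, Finset.card_range]
  intro x hx h
  have h1 : (x : ℝ) < n := by exact_mod_cast Finset.mem_range.1 hx
  linarith

theorem monicOP_eval_ne_zero_left (hw : ∀ x, 0 < w x) (hn : m + 1 ≤ n) (hz : z ≤ 0) :
    (monicOP (discreteFunctional w n) m).eval z ≠ 0 :=
  (isMonicOP_monicOP (momentDefinite_discreteFunctional hw (by omega))).eval_ne_zero_of_one_sided hw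
    (one_sided_left hz) hn

theorem monicOP_eval_ne_zero_right (hw : ∀ x, 0 < w x) (hn : m + 1 ≤ n) (hz : (n : ℝ) ≤ z + 1) :
    (monicOP (discreteFunctional w n) m).eval z ≠ 0 :=
  (isMonicOP_monicOP (momentDefinite_discreteFunctional hw (by omega))).eval_ne_zero_of_one_sided hw
    (one_sided_right hz) hn

theorem monicOP_norm_pos (hw : ∀ x, 0 < w x) (hn : m + 1 ≤ n) :
    0 < discreteFunctional w n
      (monicOP (discreteFunctional w n) m * monicOP (discreteFunctional w n) m) := by
  have hq := isMonicOP_monicOP (momentDefinite_discreteFunctional hw (by omega : m ≤ n))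
  refine discreteFunctional_mul_self_pos hw hq.monic.ne_zero ?_
  rw [hq.degree_eq]; exact_mod_cast hn

theorem opRatio_one_sided (hw : ∀ x, 0 < w x) (hn : m + 1 ≤ n) {δ : ℝ}
    (hδ : ∀ x < n, (x : ℝ) ≠ z → 0 < δ * (x - z))
    (hcard : m + 1 ≤ ((Finset.range n).filter fun x : ℕ => (x : ℝ) ≠ z).card) :
    0 < -(δ * opRatio (discreteFunctional w n) m z) := by
  have hL := momentDefinite_discreteFunctional hw hn
  have hz := (isMonicOP_monicOP (hL.mono m.le_succ)).eval_ne_zero_of_one_sided hw hδ hn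
  have hu := isMonicOP_christoffelPoly hL hz
  have h := discreteFunctional_one_sided_pos hw hδ hu.monic.ne_zero hu.degree_lt hcard
  rw [christoffelFunctional_christoffelPoly_mul_self hL hz] at h
  have hN := monicOP_norm_pos hw hn
  refine pos_of_mul_pos_left (b := discreteFunctional w n
      (monicOP (discreteFunctional w n) m * monicOP (discreteFunctional w n) m)) ?_ hN.le
  linarith

/-- The point 0 is itself a node, so one more node is required than for z < 0; with m + 1 nodes the
ratio is 0. -/
theorem opRatio_zero_neg (hw : ∀ x, 0 < w x) (hn : m + 2 ≤ n) :
    opRatio (discreteFunctional w n) m 0 < 0 := by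
  have := opRatio_one_sided hw (by omega) (one_sided_left le_rfl)
    ((by omega : m + 1 ≤ n - 1).trans (le_card_filter_ne n 0))
  linarith

theorem opRatio_neg (hw : ∀ x, 0 < w x) (hn : m + 1 ≤ n) (hz : z < 0) :
    opRatio (discreteFunctional w n) m z < 0 := by
  have := opRatio_one_sided hw hn (one_sided_left hz.le)
    (by rw [card_filter_ne_of_neg n hz]; exact hn)
  linarith

theorem opRatio_pos_last (hw : ∀ x, 0 < w x) (hn : m + 1 ≤ s) :
    0 < opRatio (discreteFunctional w (s + 1)) m s := by
  have := opRatio_one_sided (z := s) hw (by omega : m + 1 ≤ s + 1) (one_sided_right (by push_cast; rfl))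
    (hn.trans (le_card_filter_ne (s + 1) s))
  linarith

theorem opRatio_pos (hw : ∀ x, 0 < w x) (hn : m + 1 ≤ n) :
    0 < opRatio (discreteFunctional w n) m n := by
  have := opRatio_one_sided (z := n) hw hn (one_sided_right (by linarith))
    (by rw [card_filter_ne_of_le le_rfl]; exact hn)
  linarith

theorem momentDefinite_christoffelFunctional (hw : ∀ x, 0 < w x) {δ : ℝ}
    (hδ : ∀ x < n, (x : ℝ) ≠ z → 0 < δ * (x - z)) {j : ℕ}
    (hcard : j ≤ ((Finset.range n).filter fun x : ℕ => (x : ℝ) ≠ z).card) :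
    MomentDefinite (christoffelFunctional (discreteFunctional w n) z) j := by
  intro r hr h
  by_contra hr0
  have := discreteFunctional_one_sided_pos hw hδ hr0 hr hcard
  rw [h, mul_zero] at this
  exact lt_irrefl _ this

/-! ### Adding a node -/

theorem christoffelFunctional_last (w : ℕ → ℝ) (s : ℕ) :
    christoffelFunctional (discreteFunctional w (s + 1)) s =
      christoffelFunctional (discreteFunctional w s) s := by
  refine LinearMap.ext fun f => ?_
  rw [christoffelFunctional_apply, christoffelFunctional_apply, discreteFunctional_apply,
    discreteFunctional_apply, Finset.sum_range_succ]
  simp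

/-- Both levels have the same transform at s, hence the same monic orthogonal polynomial for it. -/
theorem christoffelPoly_last (hw : ∀ x, 0 < w x) (hms : m + 1 ≤ s) :
    christoffelPoly (discreteFunctional w (s + 1)) m s =
      christoffelPoly (discreteFunctional w s) m s := by
  have h1 := isMonicOP_christoffelPoly (momentDefinite_discreteFunctional hw (by omega :
    m + 1 ≤ s + 1)) (monicOP_eval_ne_zero_right (z := s) hw (by omega) (by push_cast; rfl))
  have h2 := isMonicOP_christoffelPoly (momentDefinite_discreteFunctional hw hms)
    (monicOP_eval_ne_zero_right (z := s) hw hms (by linarith))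
  rw [christoffelFunctional_last] at h1
  exact h1.unique (momentDefinite_christoffelFunctional hw (one_sided_right (by linarith))
    (by rw [card_filter_ne_of_le le_rfl]; omega)) h2

/-- The norm of the monic orthogonal polynomial of degree `m`. -/
noncomputable def levelNorm (w : ℕ → ℝ) (m n : ℕ) : ℝ :=
  discreteFunctional w n (monicOP (discreteFunctional w n) m * monicOP (discreteFunctional w n) m)

theorem levelNorm_mul_opRatio_last (hw : ∀ x, 0 < w x) (hms : m + 1 ≤ s) :
    levelNorm w m (s + 1) * opRatio (discreteFunctional w (s + 1)) m s =
      levelNorm w m s * opRatio (discreteFunctional w s) m s := by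
  have h1 := christoffelFunctional_christoffelPoly_mul_self (momentDefinite_discreteFunctional hw
    (by omega : m + 1 ≤ s + 1)) (monicOP_eval_ne_zero_right (z := s) hw (by omega) (by push_cast; rfl))
  have h2 := christoffelFunctional_christoffelPoly_mul_self (momentDefinite_discreteFunctional hw hms)
    (monicOP_eval_ne_zero_right (z := s) hw hms (by linarith))
  rw [christoffelFunctional_last, christoffelPoly_last hw hms, h2] at h1
  unfold levelNorm
  linarith

variable {β c : ℝ}

/-- The factor x kills the node 0; on the others, x w(x) = c(β + x - 1)w(x - 1) is the lower level
transformed at -β and moved by one. -/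
theorem christoffelFunctional_zero (hw : IsPearsonWeight β c w) (s : ℕ) (f : ℝ[X]) :
    christoffelFunctional (discreteFunctional w (s + 1)) 0 f =
      c * christoffelFunctional (discreteFunctional w s) (-β) (f.comp (X + C 1)) := by
  rw [christoffelFunctional_apply, christoffelFunctional_apply, discreteFunctional_apply,
    discreteFunctional_apply, Finset.sum_range_succ', Finset.mul_sum]
  simp only [eval_mul, eval_sub, eval_X, eval_C, Nat.cast_zero, sub_zero, zero_mul, mul_zero,
    add_zero, eval_comp, eval_add, Nat.cast_succ]
  refine Finset.sum_congr rfl fun x _ => ?_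
  linear_combination f.eval (x + 1 : ℝ) * hw.pearson x

theorem christoffelPoly_zero_comp (hw : IsPearsonWeight β c w) (hβ : 0 < β) (hc : 0 < c)
    (hms : m + 1 ≤ s) : (christoffelPoly (discreteFunctional w (s + 1)) m 0).comp (X + C 1) =
      christoffelPoly (discreteFunctional w s) m (-β) := by
  have h1 := isMonicOP_christoffelPoly (momentDefinite_discreteFunctional hw.pos (by omega :
    m + 1 ≤ s + 1)) (monicOP_eval_ne_zero_left (z := 0) hw.pos (by omega) le_rfl)
  have h2 := isMonicOP_christoffelPoly (momentDefinite_discreteFunctional hw.pos hms)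
    (monicOP_eval_ne_zero_left (z := -β) hw.pos hms (by linarith))
  have hL := momentDefinite_christoffelFunctional (j := m) hw.pos
    (one_sided_left (n := s) (by linarith : -β ≤ 0))
    (by rw [card_filter_ne_of_neg s (by linarith)]; omega)
  refine IsMonicOP.unique hL ⟨?_, ?_, fun f hf => ?_⟩ h2
  · exact h1.monic.comp_X_add_C 1
  · rw [natDegree_comp, natDegree_X_add_C, mul_one, h1.natDegree_eq]
  · have h3 := h1.orth _ (degree_comp_X_add_C_lt hf (-1))
    rw [christoffelFunctional_zero hw, mul_comp, comp_assoc] at h3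
    have h4 : (X + C (-1) : ℝ[X]).comp (X + C 1) = X := by
      simp
    rw [h4, comp_X] at h3
    exact (mul_eq_zero.1 h3).resolve_left hc.ne'

theorem levelNorm_mul_opRatio_zero (hw : IsPearsonWeight β c w) (hβ : 0 < β) (hc : 0 < c)
    (hms : m + 1 ≤ s) : levelNorm w m (s + 1) * opRatio (discreteFunctional w (s + 1)) m 0 =
      c * (levelNorm w m s * opRatio (discreteFunctional w s) m (-β)) := by
  have h1 := christoffelFunctional_christoffelPoly_mul_self (momentDefinite_discreteFunctional hw.pos
    (by omega : m + 1 ≤ s + 1)) (monicOP_eval_ne_zero_left (z := 0) hw.pos (by omega) le_rfl)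
  have h2 := christoffelFunctional_christoffelPoly_mul_self (momentDefinite_discreteFunctional hw.pos
    hms) (monicOP_eval_ne_zero_left (z := -β) hw.pos hms (by linarith))
  rw [christoffelFunctional_zero hw, mul_comp, christoffelPoly_zero_comp hw hβ hc hms, h2] at h1
  unfold levelNorm
  linarith

/-- Two consecutive levels have orthogonal polynomials that differ by a multiple of the common
Christoffel polynomial at the added node. -/
theorem monicOP_succ_sub (hw : ∀ x, 0 < w x) (hms : m + 1 ≤ s) : ∃ a : ℝ,
    monicOP (discreteFunctional w (s + 1)) (m + 1) - monicOP (discreteFunctional w s) (m + 1) =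
      C a * christoffelPoly (discreteFunctional w s) m s := by
  have hp := isMonicOP_monicOP (momentDefinite_discreteFunctional hw (by omega : m + 1 ≤ s + 1))
  have hp' := isMonicOP_monicOP (momentDefinite_discreteFunctional hw hms)
  have hu := isMonicOP_christoffelPoly (momentDefinite_discreteFunctional hw hms)
    (monicOP_eval_ne_zero_right (z := s) hw hms (by linarith))
  refine ⟨_, hu.eq_C_mul (momentDefinite_christoffelFunctional hw (one_sided_right (by linarith))
    (by rw [card_filter_ne_of_le le_rfl]; omega)) ?_ fun f hf => ?_⟩
  · have := degree_sub_smul_lt hp'.monic hp'.natDegree_eq hp.degree_lt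
    rwa [hp.coeff_self, C_1, one_mul] at this
  -- Each of the two polynomials of degree m + 1 is orthogonal to (X - s)f at its own level, so
  -- both, and their difference, are orthogonal to f for the common transform.
  · have hd : ((X - C (s : ℝ)) * f : ℝ[X]).degree < (m + 1 : ℕ) := by
      rw [degree_mul, degree_X_sub_C, add_comm]
      by_cases h0 : f = 0
      · simp [h0]
      · rw [degree_eq_natDegree h0] at hf ⊢
        have : f.natDegree < m := by exact_mod_cast hf
        exact_mod_cast (by omega : f.natDegree + 1 < m + 1)
    rw [sub_mul, map_sub, ← christoffelFunctional_last, christoffelFunctional_apply, mul_left_comm,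
      hp.orth _ hd, christoffelFunctional_last, christoffelFunctional_apply, mul_left_comm,
      hp'.orth _ hd, sub_zero]

end LevelChange

/-! ### The sequences e, f, g, h and their recurrences. -/

section Sequences

open Polynomial

/-- The sequence `e`. -/
noncomputable def seqE (w : ℕ → ℝ) (m s : ℕ) : ℝ :=
  -(levelNorm w m (s + 1) * opRatio (discreteFunctional w (s + 1)) m 0)

/-- The sequence `f`. -/
noncomputable def seqF (w : ℕ → ℝ) (m s : ℕ) : ℝ :=
  s * opRatio (discreteFunctional w s) m 0 /
    (opRatio (discreteFunctional w s) m 0 - opRatio (discreteFunctional w s) m s)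

/-- The sequence `g`. -/
noncomputable def seqG (w : ℕ → ℝ) (m s : ℕ) : ℝ :=
  -(opRatio (discreteFunctional w (s + 1)) m s / opRatio (discreteFunctional w (s + 1)) m 0)

/-- The sequence `h`. -/
noncomputable def seqH (w : ℕ → ℝ) (m s : ℕ) : ℝ :=
  (monicOP (discreteFunctional w s) (m + 1)).eval (s : ℝ)

/-- The elimination behind `seqF_succ_identities`. The indices ₀, b, s, n mark values at 0, -β, s, s
+ 1; A = K_0(s+1), B = K_{-β}(s), J = (s+1)w(s+1), κ = β + m, σ = β + s. Christoffel–Darboux gives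
`hA`, `hB`; the three kernel relations are `h1`, `h2`, `h3`. -/
theorem kernel_ratio_identities {p₀ q₀ pb qb ps qs pn qn N A B J c κ σ n : ℝ}
    (hq₀ : q₀ ≠ 0) (hqb : qb ≠ 0) (hqs : qs ≠ 0) (hqn : qn ≠ 0) (hN : N ≠ 0) (hJ : J ≠ 0)
    (hn : n ≠ 0) (hσ : σ ≠ 0) (h₀ : p₀ / q₀ - pn / qn ≠ 0) (hb : pb / qb - ps / qs ≠ 0)
    (hp₀ : p₀ ≠ 0)
    (hA : N * (n * A) = q₀ * pn - p₀ * qn) (hB : N * (σ * B) = qb * ps - pb * qs)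
    (h1 : (1 - c) * p₀ + c * κ * q₀ = J * qs * A) (h2 : (1 - c) * pb + κ * qb = J * qn * B)
    (h3 : p₀ * qb - c * pb * q₀ = N * J * A * B) :
    n * (p₀ / q₀) / (p₀ / q₀ - pn / qn) + κ = σ * (pb / qb) / (pb / qb - ps / qs) ∧
    (1 + c * -((ps / qs) / (p₀ / q₀))) * (n * (p₀ / q₀) / (p₀ / q₀ - pn / qn)) + κ - σ =
      -((1 - c) * (ps / qs)) := by
  have e₀ : p₀ / q₀ - pn / qn = -(N * n * A) / (q₀ * qn) := by
    field_simp; linear_combination hA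
  have eb : pb / qb - ps / qs = -(N * σ * B) / (qb * qs) := by
    field_simp; linear_combination hB
  have hA0 : A ≠ 0 := by rintro rfl; apply h₀; rw [e₀]; simp
  have hB0 : B ≠ 0 := by rintro rfl; apply hb; rw [eb]; simp
  have hf : n * (p₀ / q₀) / (p₀ / q₀ - pn / qn) = -(p₀ * qn) / (N * A) := by
    rw [e₀]; field_simp
  have hf' : σ * (pb / qb) / (pb / qb - ps / qs) = -(pb * qs) / (N * B) := by
    rw [eb]; field_simp
  have hI : n * (p₀ / q₀) / (p₀ / q₀ - pn / qn) + κ =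
      σ * (pb / qb) / (pb / qb - ps / qs) := by
    rw [hf, hf', div_add' _ _ _ (by positivity), div_eq_div_iff (by positivity) (by positivity)]
    refine mul_left_cancel₀ hJ ?_
    linear_combination N * (p₀ * h2 - κ * h3 - pb * h1)
  refine ⟨hI, ?_⟩
  have hs : n * (p₀ / q₀) / (p₀ / q₀ - pn / qn) + κ - σ = -(qb * ps) / (N * B) := by
    rw [hI, hf', div_sub' (by positivity), div_eq_div_iff (by positivity) (by positivity)]
    linear_combination -(N * B) * hB
  have : (1 + c * -((ps / qs) / (p₀ / q₀))) * (n * (p₀ / q₀) / (p₀ / q₀ - pn / qn)) + κ - σ =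
      (n * (p₀ / q₀) / (p₀ / q₀ - pn / qn) + κ - σ) +
        c * -((ps / qs) / (p₀ / q₀)) * (n * (p₀ / q₀) / (p₀ / q₀ - pn / qn)) := by ring
  rw [this, hs, hf]
  have h4 : qb * qs * A - c * q₀ * qn * B = (1 - c) * (N * A * B) := by
    refine mul_left_cancel₀ hJ ?_
    linear_combination -qb * h1 + c * q₀ * h2 + (1 - c) * h3
  field_simp
  linear_combination -ps * h4

variable {β c : ℝ} {w : ℕ → ℝ} {m s : ℕ}

/-- By definition f_{s+1} involves the points 0 and s + 1; the first identity expresses it through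
-β and s instead. The second evaluates the denominator in the recurrence for e and shows that it is
nonzero. -/
theorem seqF_succ_identities (hw : IsPearsonWeight β c w) (hβ : 0 < β)
    (hms : m + 1 ≤ s) :
    seqF w m (s + 1) + (β + m) = (β + s) * opRatio (discreteFunctional w (s + 1)) m (-β) /
      (opRatio (discreteFunctional w (s + 1)) m (-β) -
        opRatio (discreteFunctional w (s + 1)) m s) ∧
    (1 + c * seqG w m s) * seqF w m (s + 1) + (β + m) - (β + s) =
      -((1 - c) * opRatio (discreteFunctional w (s + 1)) m s) := by
  have hL := momentDefinite_discreteFunctional hw.pos (by omega : m + 1 ≤ s + 1)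
  have hp := isMonicOP_monicOP hL
  have hq := isMonicOP_monicOP (hL.mono m.le_succ)
  have hK := isReproducing_reprKernel hL
  have hms' : m ≤ s := by omega
  have ht₀ := opRatio_zero_neg hw.pos (by omega : m + 2 ≤ s + 1)
  have htb := opRatio_neg hw.pos (by omega : m + 1 ≤ s + 1) (by linarith : -β < 0)
  have hts := opRatio_pos_last hw.pos hms
  have htn := opRatio_pos hw.pos (by omega : m + 1 ≤ s + 1)
  have hq₀ := monicOP_eval_ne_zero_left hw.pos (by omega : m + 1 ≤ s + 1) (le_refl (0 : ℝ))
  have hA := hK.christoffel_darboux_eval hL hp hq (s + 1 : ℕ) 0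
  have hB := hK.christoffel_darboux_eval hL hp hq s (-β)
  have h3 := hw.kernel_kernel hms' hp hq hK (-β) 0
  have hc₀ := hK.norm_mul_coeff hq 0
  have hcb := hK.norm_mul_coeff hq (-β)
  have hN := hq.norm_ne_zero hL
  have hp₀ : (monicOP (discreteFunctional w (s + 1)) (m + 1)).eval 0 ≠ 0 := fun h => by
    simp [opRatio, h] at ht₀
  have hJ : ((s : ℝ) + 1) * w (s + 1) ≠ 0 := mul_ne_zero (by positivity) (hw.pos _).ne'
  unfold seqF seqG
  unfold opRatio at *
  push_cast at *
  refine kernel_ratio_identities hq₀ (monicOP_eval_ne_zero_left hw.pos (by omega) (by linarith))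
    (monicOP_eval_ne_zero_right hw.pos (by omega) (by push_cast; rfl))
    (monicOP_eval_ne_zero_right hw.pos (by omega) (by push_cast; linarith)) hN hJ (by positivity)
    (by positivity) (by linarith) (by linarith) hp₀ (by linear_combination hA)
    (by linear_combination hB) (hw.kernel_zero hms' hp hq hK) (hw.kernel_neg_beta hms' hp hq hK) ?_
  rw [← hc₀, ← hcb]
  linear_combination discreteFunctional w (s + 1) (monicOP (discreteFunctional w (s + 1)) m *
    monicOP (discreteFunctional w (s + 1)) m) * h3

/-- Multiplied by the norm, both ratios in g_s are norms of Christoffel polynomials, which pass to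
the lower level; the norms then cancel. -/
theorem seqG_eq_lower (hw : IsPearsonWeight β c w) (hβ : 0 < β) (hc : 0 < c) (hms : m + 1 ≤ s) :
    seqG w m s = -(opRatio (discreteFunctional w s) m s /
      (c * opRatio (discreteFunctional w s) m (-β))) := by
  have h1 := levelNorm_mul_opRatio_last hw.pos hms
  have h2 := levelNorm_mul_opRatio_zero hw hβ hc hms
  have hN : levelNorm w m (s + 1) ≠ 0 := (monicOP_norm_pos hw.pos (by omega)).ne'
  have hN' : levelNorm w m s ≠ 0 := (monicOP_norm_pos hw.pos hms).ne'
  rw [seqG, ← mul_div_mul_left _ _ hN, h1, h2, ← mul_left_comm, mul_div_mul_left _ _ hN']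

theorem seqE_eq_lower (hw : IsPearsonWeight β c w) (hβ : 0 < β) (hc : 0 < c) (hms : m + 1 ≤ s) :
    seqE w m s = -(c * (levelNorm w m s * opRatio (discreteFunctional w s) m (-β))) := by
  rw [seqE, levelNorm_mul_opRatio_zero hw hβ hc hms]

theorem seqE_pos (hw : IsPearsonWeight β c w) (hms : m + 1 ≤ s) : 0 < seqE w m s := by
  have h1 := opRatio_zero_neg hw.pos (by omega : m + 2 ≤ s + 1)
  have hN : 0 < levelNorm w m (s + 1) := monicOP_norm_pos hw.pos (by omega)
  unfold seqE
  nlinarith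

theorem seqG_pos (hw : IsPearsonWeight β c w) (hms : m + 1 ≤ s) : 0 < seqG w m s := by
  rw [seqG, ← div_neg]
  exact div_pos (opRatio_pos_last hw.pos hms)
    (neg_pos.2 (opRatio_zero_neg hw.pos (by omega : m + 2 ≤ s + 1)))

theorem seqF_succ_pos (hw : IsPearsonWeight β c w) (hms : m + 1 ≤ s) : 0 < seqF w m (s + 1) := by
  have h1 := opRatio_zero_neg hw.pos (by omega : m + 2 ≤ s + 1)
  have h2 := opRatio_pos hw.pos (by omega : m + 1 ≤ s + 1)
  exact div_pos_of_neg_of_neg (mul_neg_of_pos_of_neg (by positivity) h1) (by linarith)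

theorem seqF_den_ne_zero (hw : IsPearsonWeight β c w) (hβ : 0 < β) (hc1 : c < 1)
    (hms : m + 1 ≤ s) : (1 + c * seqG w m s) * seqF w m (s + 1) + (β + m) - (β + s) ≠ 0 := by
  rw [(seqF_succ_identities hw hβ hms).2]
  exact neg_ne_zero.2 (mul_pos (by linarith) (opRatio_pos_last hw.pos hms)).ne'

/-- At level s + 1 one has g_s g_{s+1} = t_{s+1} t_s / (c t_0 t_{-β}). The two expressions for f =
f_{s+1} give (f - s - 1)/f = t_{s+1}/t_0 and (f + m - s)/(f + β + m) = t_s/t_{-β}. -/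
theorem seqG_succ (hw : IsPearsonWeight β c w) (hβ : 0 < β) (hc : 0 < c) (hms : m + 1 ≤ s) :
    seqG w m (s + 1) = (seqF w m (s + 1) - 1 - s) * (seqF w m (s + 1) - 1 - s + (m + 1)) /
      (c * seqG w m s * seqF w m (s + 1) * (seqF w m (s + 1) + (β + m))) := by
  have ht₀ := opRatio_zero_neg hw.pos (by omega : m + 2 ≤ s + 1)
  have htb := opRatio_neg hw.pos (by omega : m + 1 ≤ s + 1) (by linarith : -β < 0)
  have hts := opRatio_pos_last hw.pos hms
  have htn := opRatio_pos hw.pos (by omega : m + 1 ≤ s + 1)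
  have hI := (seqF_succ_identities hw hβ hms).1
  have hX : seqF w m (s + 1) - 1 - s + (m + 1) = seqF w m (s + 1) + (β + m) - (β + s) := by ring
  rw [seqG_eq_lower hw hβ hc (by omega), hX, hI, seqF, seqG]
  push_cast at *
  generalize opRatio (discreteFunctional w (s + 1)) m 0 = t₀ at *
  generalize opRatio (discreteFunctional w (s + 1)) m (-β) = tb at *
  generalize opRatio (discreteFunctional w (s + 1)) m s = ts at *
  generalize opRatio (discreteFunctional w (s + 1)) m (s + 1) = tn at *
  have hσ : β + (s : ℝ) ≠ 0 := by positivity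
  have hn : (s : ℝ) + 1 ≠ 0 := by positivity
  have e1 : (s + 1) * t₀ / (t₀ - tn) - 1 - s = (s + 1) * tn / (t₀ - tn) := by
    rw [eq_div_iff (by linarith), sub_sub, sub_mul, div_mul_cancel₀ _ (by linarith)]; ring
  have e2 : (β + s) * tb / (tb - ts) - (β + s) = (β + s) * ts / (tb - ts) := by
    rw [eq_div_iff (by linarith), sub_mul, div_mul_cancel₀ _ (by linarith)]; ring
  rw [e1, e2]
  have h1 : t₀ - tn ≠ 0 := by linarith
  have h2 : tb - ts ≠ 0 := by linarith
  have h3 := ht₀.ne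
  have h4 := htb.ne
  have h5 := hts.ne'
  have h6 := hc.ne'
  field_simp

theorem seqE_succ (hw : IsPearsonWeight β c w) (hβ : 0 < β) (hc : 0 < c) (hc1 : c < 1)
    (hms : m + 1 ≤ s) :
    seqE w m (s + 1) = -(c * seqE w m s * seqG w m s / seqG w m (s + 1)) *
      (((1 + seqG w m (s + 1)) * seqF w m (s + 1) + (β + m) * seqG w m (s + 1) - s - 1) /
      ((1 + c * seqG w m s) * seqF w m (s + 1) + (β + m) - (β + s))) := by
  have hden := seqF_den_ne_zero hw hβ hc1 hms
  have ht₀ := opRatio_zero_neg hw.pos (by omega : m + 2 ≤ s + 1)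
  have htb := opRatio_neg hw.pos (by omega : m + 1 ≤ s + 1) (by linarith : -β < 0)
  have hts := opRatio_pos_last hw.pos hms
  have htn := opRatio_pos hw.pos (by omega : m + 1 ≤ s + 1)
  have hI := (seqF_succ_identities hw hβ hms).1
  have hg' := (seqG_pos hw (by omega : m + 1 ≤ s + 1)).ne'
  have hf : seqF w m (s + 1) * (opRatio (discreteFunctional w (s + 1)) m 0 -
      opRatio (discreteFunctional w (s + 1)) m (s + 1 : ℕ)) =
      (s + 1) * opRatio (discreteFunctional w (s + 1)) m 0 := by
    rw [seqF, div_mul_cancel₀ _ (by linarith)]; push_cast; rfl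
  rw [eq_div_iff (by linarith)] at hI
  rw [← neg_div, div_mul_div_comm, eq_div_iff (mul_ne_zero hg' hden)]
  -- The lower forms at index s + 1 put all quantities on level s + 1: e_{s+1} = -c N t_{-β}, while
  -- e_s = -N t_0.
  rw [seqE_eq_lower hw hβ hc (by omega : m + 1 ≤ s + 1)]
  rw [seqG_eq_lower hw hβ hc (by omega : m + 1 ≤ s + 1), seqG, seqE]
  generalize seqF w m (s + 1) = f at *
  generalize opRatio (discreteFunctional w (s + 1)) m 0 = t₀ at *
  generalize opRatio (discreteFunctional w (s + 1)) m (-β) = tb at *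
  generalize opRatio (discreteFunctional w (s + 1)) m s = ts at *
  generalize opRatio (discreteFunctional w (s + 1)) m (s + 1 : ℕ) = tn at *
  generalize levelNorm w m (s + 1) = N
  have h3 := ht₀.ne
  have h4 := htb.ne
  have h6 := hc.ne'
  field_simp
  linear_combination N * (tn * t₀ * hI + c * ts * tb * hf)

/-- The common Christoffel polynomial, at s + 1 on the upper level and at s on the lower one. This
carries q from one level to the next in `seqH_succ` and `gap_ratio_difference`. -/
theorem christoffelPoly_eval_succ (hw : IsPearsonWeight β c w) (hβ : 0 < β) (hc : 0 < c)
    (hms : m + 1 ≤ s) :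
    (monicOP (discreteFunctional w (s + 1)) m).eval (s + 1 : ℝ) *
        (opRatio (discreteFunctional w (s + 1)) m (s + 1 : ℕ) -
          opRatio (discreteFunctional w (s + 1)) m 0) / (s + 1) =
      (monicOP (discreteFunctional w s) m).eval (s : ℝ) *
        (opRatio (discreteFunctional w s) m s - opRatio (discreteFunctional w s) m (-β)) /
          (β + s) := by
  have h0 := congrArg (eval (s : ℝ)) (christoffelPoly_zero_comp hw hβ hc hms)
  have h1 := congrArg (eval (s + 1 : ℝ)) (X_sub_C_mul_christoffelPoly (z := 0)
    (momentDefinite_discreteFunctional hw.pos (by omega : m + 1 ≤ s + 1))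
    (monicOP_eval_ne_zero_left hw.pos (by omega) le_rfl))
  have h2 := congrArg (eval (s : ℝ)) (X_sub_C_mul_christoffelPoly (z := -β)
    (momentDefinite_discreteFunctional hw.pos hms)
    (monicOP_eval_ne_zero_left hw.pos (by omega) (by linarith)))
  have hqn := monicOP_eval_ne_zero_right (z := (s + 1 : ℕ)) hw.pos (by omega : m + 1 ≤ s + 1)
    (by push_cast; linarith)
  have hqs := monicOP_eval_ne_zero_right (z := s) hw.pos hms (by linarith)
  have hpn : (monicOP (discreteFunctional w (s + 1)) (m + 1)).eval ((s + 1 : ℕ) : ℝ) =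
      opRatio (discreteFunctional w (s + 1)) m (s + 1 : ℕ) *
        (monicOP (discreteFunctional w (s + 1)) m).eval ((s + 1 : ℕ) : ℝ) :=
    (div_mul_cancel₀ _ hqn).symm
  have hps : (monicOP (discreteFunctional w s) (m + 1)).eval (s : ℝ) =
      opRatio (discreteFunctional w s) m s * (monicOP (discreteFunctional w s) m).eval (s : ℝ) :=
    (div_mul_cancel₀ _ hqs).symm
  simp only [eval_comp, eval_add, eval_X, eval_C, eval_mul, eval_sub] at h0 h1 h2
  have hσ : β + (s : ℝ) ≠ 0 := by positivity
  have hn : (s : ℝ) + 1 ≠ 0 := by positivity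
  rw [h0] at h1
  push_cast at *
  rw [div_eq_div_iff hn hσ]
  rw [hpn] at h1
  rw [hps] at h2
  linear_combination -(β + s) * h1 + (s + 1) * h2

theorem seqH_succ (hw : IsPearsonWeight β c w) (hβ : 0 < β) (hc : 0 < c) (hms : m + 1 ≤ s) :
    seqH w m (s + 1) = (1 + c * seqG w m s) * (s + 1 - seqF w m (s + 1)) /
      (c * (β + s) * seqG w m s) * seqH w m s := by
  have ht₀ := opRatio_zero_neg hw.pos (by omega : m + 2 ≤ s + 1)
  have htn := opRatio_pos hw.pos (by omega : m + 1 ≤ s + 1)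
  have hτb := opRatio_neg hw.pos hms (by linarith : -β < 0)
  have hτs := opRatio_pos hw.pos hms
  have hu := christoffelPoly_eval_succ hw hβ hc hms
  have hqn := monicOP_eval_ne_zero_right (z := (s + 1 : ℕ)) hw.pos (by omega : m + 1 ≤ s + 1)
    (by push_cast; linarith)
  have hqs := monicOP_eval_ne_zero_right (z := s) hw.pos hms (by linarith)
  have hpn : seqH w m (s + 1) =
      opRatio (discreteFunctional w (s + 1)) m (s + 1 : ℕ) *
        (monicOP (discreteFunctional w (s + 1)) m).eval ((s + 1 : ℕ) : ℝ) :=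
    (div_mul_cancel₀ _ hqn).symm
  have hps : seqH w m s =
      opRatio (discreteFunctional w s) m s * (monicOP (discreteFunctional w s) m).eval (s : ℝ) :=
    (div_mul_cancel₀ _ hqs).symm
  have hσ : β + (s : ℝ) ≠ 0 := by positivity
  have hn : (s : ℝ) + 1 ≠ 0 := by positivity
  rw [hpn, hps, seqG_eq_lower hw hβ hc hms, seqF]
  push_cast at *
  generalize opRatio (discreteFunctional w (s + 1)) m 0 = t₀ at *
  generalize opRatio (discreteFunctional w (s + 1)) m (s + 1) = tn at *
  generalize opRatio (discreteFunctional w s) m s = τs at *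
  generalize opRatio (discreteFunctional w s) m (-β) = τb at *
  generalize (monicOP (discreteFunctional w (s + 1)) m).eval ((s : ℝ) + 1) = qn at *
  generalize (monicOP (discreteFunctional w s) m).eval (s : ℝ) = qs at *
  have h1 : t₀ - tn ≠ 0 := by linarith
  have e1 : (s : ℝ) + 1 - (s + 1) * t₀ / (t₀ - tn) = -((s + 1) * tn / (t₀ - tn)) := by
    rw [eq_neg_iff_add_eq_zero, sub_add, sub_eq_zero, ← sub_div, eq_div_iff h1]; ring
  rw [e1]
  rw [div_eq_div_iff hn hσ] at hu
  have h3 := hτb.ne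
  have h5 := hτs.ne'
  have h6 := hc.ne'
  field_simp
  linear_combination -hu

/-- Let v be the Christoffel polynomial at s, common to levels s and s + 1. Each of the four
fractions is -p(z)/v(z) with z = 0 or -β and p from one of the levels. Since the two polynomials p
differ by a constant multiple of v, the difference of p/v between the levels is the same at 0 and at
-β. -/
theorem seqF_succ (hw : IsPearsonWeight β c w) (hβ : 0 < β) (hc : 0 < c) (hms : m + 1 ≤ s) :
    seqF w m (s + 1) = -(β + m) - seqF w m s + s / (1 + seqG w m s) +
      (β + s) / (1 + c * seqG w m s) := by
  have ht₀ := opRatio_zero_neg hw.pos (by omega : m + 2 ≤ s + 1)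
  have htb := opRatio_neg hw.pos (by omega : m + 1 ≤ s + 1) (by linarith : -β < 0)
  have hts := opRatio_pos_last hw.pos hms
  have hτb := opRatio_neg hw.pos hms (by linarith : -β < 0)
  have hτs := opRatio_pos hw.pos hms
  have hL := momentDefinite_discreteFunctional hw.pos (by omega : m + 1 ≤ s + 1)
  have hL' := momentDefinite_discreteFunctional hw.pos hms
  have hqs := monicOP_eval_ne_zero_right (z := s) hw.pos (by omega : m + 1 ≤ s + 1)
    (by push_cast; rfl)
  have hqs' := monicOP_eval_ne_zero_right (z := s) hw.pos hms (by linarith)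
  have hv := X_sub_C_mul_christoffelPoly hL hqs
  have hv' := X_sub_C_mul_christoffelPoly hL' hqs'
  rw [christoffelPoly_last hw.pos hms] at hv
  obtain ⟨a, ha⟩ := monicOP_succ_sub hw.pos hms
  have hpq : ∀ {n : ℕ} {z : ℝ}, (monicOP (discreteFunctional w n) m).eval z ≠ 0 →
      (monicOP (discreteFunctional w n) (m + 1)).eval z =
      opRatio (discreteFunctional w n) m z * (monicOP (discreteFunctional w n) m).eval z :=
    fun h => (div_mul_cancel₀ _ h).symm
  have hq₀ := monicOP_eval_ne_zero_left hw.pos (by omega : m + 1 ≤ s + 1) (le_refl (0 : ℝ))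
  have hqb := monicOP_eval_ne_zero_left hw.pos (by omega : m + 1 ≤ s + 1) (by linarith : -β ≤ 0)
  have hq₀' := monicOP_eval_ne_zero_left hw.pos hms (le_refl (0 : ℝ))
  have hqb' := monicOP_eval_ne_zero_left hw.pos hms (by linarith : -β ≤ 0)
  have hI := (seqF_succ_identities hw hβ hms).1
  have v0 := congrArg (eval 0) hv
  have vb := congrArg (eval (-β)) hv
  have v0' := congrArg (eval 0) hv'
  have vb' := congrArg (eval (-β)) hv'
  have a0 := congrArg (eval 0) ha
  have ab := congrArg (eval (-β)) ha
  simp only [eval_mul, eval_sub, eval_X, eval_C, hpq hq₀, hpq hqb, hpq hq₀', hpq hqb'] at v0 vb v0' vb' a0 ab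
  have hg : s / (1 + seqG w m s) = s * opRatio (discreteFunctional w (s + 1)) m 0 /
      (opRatio (discreteFunctional w (s + 1)) m 0 -
        opRatio (discreteFunctional w (s + 1)) m s) := by
    have h1 : opRatio (discreteFunctional w (s + 1)) m 0 -
        opRatio (discreteFunctional w (s + 1)) m s ≠ 0 := by linarith
    have h2 := seqG_pos hw hms
    rw [div_eq_div_iff (by linarith) h1, seqG]
    have h3 := ht₀.ne
    field_simp
    ring
  have hg' : (β + s) / (1 + c * seqG w m s) = (β + s) * opRatio (discreteFunctional w s) m (-β) /
      (opRatio (discreteFunctional w s) m (-β) - opRatio (discreteFunctional w s) m s) := by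
    have h1 : opRatio (discreteFunctional w s) m (-β) - opRatio (discreteFunctional w s) m s ≠ 0 := by
      linarith
    have h2 := mul_pos hc (seqG_pos hw hms)
    rw [div_eq_div_iff (by linarith) h1, seqG_eq_lower hw hβ hc hms]
    have h3 := hτb.ne
    have h6 := hc.ne'
    field_simp
    ring
  have hI' : seqF w m (s + 1) = -(β + m) + (β + s) * opRatio (discreteFunctional w (s + 1)) m (-β) /
      (opRatio (discreteFunctional w (s + 1)) m (-β) -
        opRatio (discreteFunctional w (s + 1)) m s) := by linarith
  rw [hI', hg, hg', seqF]
  have hs : (s : ℝ) ≠ 0 := by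
    have : s ≠ 0 := by omega
    exact_mod_cast this
  have hσ : β + (s : ℝ) ≠ 0 := by positivity
  generalize opRatio (discreteFunctional w (s + 1)) m 0 = t₀ at *
  generalize opRatio (discreteFunctional w (s + 1)) m (-β) = tb at *
  generalize opRatio (discreteFunctional w (s + 1)) m s = ts at *
  generalize opRatio (discreteFunctional w s) m 0 = τ₀ at *
  generalize opRatio (discreteFunctional w s) m (-β) = τb at *
  generalize opRatio (discreteFunctional w s) m s = τs at *
  generalize (monicOP (discreteFunctional w s) m).eval 0 = q₀' at *
  generalize (monicOP (discreteFunctional w s) m).eval (-β) = qb' at *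
  generalize (monicOP (discreteFunctional w (s + 1)) m).eval 0 = q₀ at *
  generalize (monicOP (discreteFunctional w (s + 1)) m).eval (-β) = qb at *
  generalize (christoffelPoly (discreteFunctional w s) m s).eval 0 = v₀ at *
  generalize (christoffelPoly (discreteFunctional w s) m s).eval (-β) = vB at *
  have key : ∀ {σ t t' q v : ℝ}, σ ≠ 0 → t - t' ≠ 0 → q ≠ 0 → -σ * v = t * q - t' * q →
      v ≠ 0 ∧ σ * t / (t - t') = -(t * q) / v := by
    intro σ t t' q v hσ ht hq h
    have hv : v ≠ 0 := by
      rintro rfl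
      have : (t - t') * q = 0 := by linear_combination -h
      exact mul_ne_zero ht hq this
    refine ⟨hv, ?_⟩
    rw [div_eq_div_iff ht hv]
    linear_combination -t * h
  have hv0 : v₀ ≠ 0 := (key (v := v₀) hs (by linarith : t₀ - ts ≠ 0) hq₀ (by linear_combination v0)).1
  -- `opRatio_zero_neg` does not cover level s = m + 1, where τ₀ = 0; the difference is controlled
  -- through v(0) ≠ 0 instead.
  have hτ₀ : τ₀ - τs ≠ 0 := by
    intro h
    have : (s : ℝ) * v₀ = 0 := by linear_combination -v0' - q₀' * h
    exact mul_ne_zero hs hv0 this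
  have hvb := (key (v := vB) hσ (by linarith : tb - ts ≠ 0) hqb (by linear_combination vb)).1
  rw [(key (v := v₀) hs (by linarith : t₀ - ts ≠ 0) hq₀ (by linear_combination v0)).2,
    (key (v := vB) hσ (by linarith : tb - ts ≠ 0) hqb (by linear_combination vb)).2,
    (key (v := v₀) hs hτ₀ hq₀' (by linear_combination v0')).2,
    (key (v := vB) hσ (by linarith : τb - τs ≠ 0) hqb' (by linear_combination vb')).2]
  field_simp
  linear_combination vB * a0 - v₀ * ab

end Sequences

/-! ### Ratios of Hankel determinants under the addition of a node. -/

section GapRatio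

open Polynomial Matrix

variable {w : ℕ → ℝ} {β c : ℝ} {m s : ℕ}

theorem momentMatrix_succ (w : ℕ → ℝ) (s k : ℕ) :
    momentMatrix (discreteFunctional w (s + 1)) k = momentMatrix (discreteFunctional w s) k +
      replicateCol Unit (fun i : Fin k => w s * (s : ℝ) ^ (i : ℕ)) *
        replicateRow Unit (fun i : Fin k => (s : ℝ) ^ (i : ℕ)) := by
  ext i j
  simp only [momentMatrix, of_apply, Matrix.add_apply, discreteFunctional_apply, Finset.sum_range_succ,
    mul_apply, replicateCol_apply, replicateRow_apply, Finset.univ_unique, Finset.sum_singleton,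
    eval_mul, eval_pow, eval_X, pow_add]
  ring

/-- Matrix determinant lemma for the rank-one update; the quadratic form of the inverse moment
matrix is the kernel. -/
theorem det_momentMatrix_succ (hw : ∀ x, 0 < w x) {k : ℕ} (hk : k ≤ s) :
    (momentMatrix (discreteFunctional w (s + 1)) k).det =
      (momentMatrix (discreteFunctional w s) k).det *
        (1 + w s * (reprKernel (discreteFunctional w s) k s).eval (s : ℝ)) := by
  have hL := momentDefinite_discreteFunctional hw hk
  rw [momentMatrix_succ, det_add_replicateCol_mul_replicateRow
    (momentMatrix_det_ne_zero hL).isUnit, eval_reprKernel]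
  congr 1
  rw [det_unique]
  simp only [Matrix.add_apply, one_apply_eq, mul_apply, replicateRow_apply, replicateCol_apply, dotProduct,
    mulVec, Finset.mul_sum, Finset.sum_mul]
  congr 1
  rw [Finset.sum_comm]
  refine Finset.sum_congr rfl fun i _ => Finset.sum_congr rfl fun j _ => ?_
  ring

theorem reprKernel_diag_nonneg (hw : ∀ x, 0 < w x) {k : ℕ} (hk : k ≤ s) (z : ℝ) :
    0 ≤ (reprKernel (discreteFunctional w s) k z).eval z := by
  have hK := isReproducing_reprKernel (momentDefinite_discreteFunctional hw hk)
  rw [← hK.repr z _ (hK.degree_lt z), discreteFunctional_apply]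
  exact Finset.sum_nonneg fun x _ => by rw [eval_mul]; exact mul_nonneg (hw x).le (mul_self_nonneg _)

theorem det_momentMatrix_pos (hw : ∀ x, 0 < w x) {k : ℕ} (hk : k ≤ s)
    (h0 : 0 < (momentMatrix (discreteFunctional w k) k).det) :
    0 < (momentMatrix (discreteFunctional w s) k).det := by
  induction s, hk using Nat.le_induction with
  | base => exact h0
  | succ s hs ih =>
    rw [det_momentMatrix_succ hw hs]
    have := mul_nonneg (hw s).le (reprKernel_diag_nonneg hw hs s)
    positivity

/-- Adding the node `s` divides the reproducing kernel at `s` by a constant. -/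
theorem reprKernel_succ (hw : ∀ x, 0 < w x) {k : ℕ} (hk : k ≤ s) :
    C (1 + w s * (reprKernel (discreteFunctional w s) k s).eval (s : ℝ)) *
      reprKernel (discreteFunctional w (s + 1)) k s = reprKernel (discreteFunctional w s) k s := by
  have hL := momentDefinite_discreteFunctional hw (hk.trans s.le_succ)
  have hK' := isReproducing_reprKernel (momentDefinite_discreteFunctional hw hk)
  have hK := isReproducing_reprKernel hL
  set ρ := 1 + w s * (reprKernel (discreteFunctional w s) k s).eval (s : ℝ) with hρ
  have hρ0 : ρ ≠ 0 := by
    have := mul_nonneg (hw s).le (reprKernel_diag_nonneg hw hk s)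
    positivity
  rw [← hK.eq_of_repr hL (z := s) (r := C ρ⁻¹ * reprKernel (discreteFunctional w s) k s)]
  · rw [← mul_assoc, ← C_mul, mul_inv_cancel₀ hρ0, C_1, one_mul]
  · rw [← smul_eq_C_mul]
    exact (degree_smul_le _ _).trans_lt (hK'.degree_lt s)
  · intro f hf
    have h1 : discreteFunctional w (s + 1) (reprKernel (discreteFunctional w s) k s * f) =
        ρ * f.eval (s : ℝ) := by
      have h2 := hK'.repr s f hf
      rw [discreteFunctional_apply] at h2 ⊢
      rw [Finset.sum_range_succ, h2, eval_mul, hρ]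
      ring
    rw [mul_assoc, map_C_mul, h1, ← mul_assoc, inv_mul_cancel₀ hρ0, one_mul]

/-- `kernel_kernel` at (s, s + 1) relates the diagonal values at s + 1 and s of the upper kernel,
with a product of both as boundary term. `reprKernel_succ` replaces the value at s by the lower one
and removes the product, so the difference collapses to a single term. -/
theorem gap_ratio_difference (hw : IsPearsonWeight β c w) (hβ : 0 < β) (hc : 0 < c)
    (hms : m + 1 ≤ s) :
    w (s + 1) * (reprKernel (discreteFunctional w (s + 1)) (m + 1) (s + 1 : ℕ)).eval
        ((s + 1 : ℕ) : ℝ) -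
      w s * (reprKernel (discreteFunctional w s) (m + 1) s).eval (s : ℝ) =
    w s / (c * (s + 1) * (β + s)) * ((1 + c * seqG w m s) / (seqE w m s * seqG w m s ^ 2)) *
      ((1 + c * seqG w m s) * seqF w m (s + 1) - s - 1) * seqH w m s ^ 2 := by
  have hL := momentDefinite_discreteFunctional hw.pos (by omega : m + 1 ≤ s + 1)
  have hL' := momentDefinite_discreteFunctional hw.pos hms
  have hp := isMonicOP_monicOP hL
  have hq := isMonicOP_monicOP (hL.mono m.le_succ)
  have hq' := isMonicOP_monicOP (hL'.mono m.le_succ)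
  have hK := isReproducing_reprKernel hL
  have hK' := isReproducing_reprKernel hL'
  have ht₀ := opRatio_zero_neg hw.pos (by omega : m + 2 ≤ s + 1)
  have hts := opRatio_pos_last hw.pos hms
  have htn := opRatio_pos hw.pos (by omega : m + 1 ≤ s + 1)
  have hτb := opRatio_neg hw.pos hms (by linarith : -β < 0)
  have hτs := opRatio_pos hw.pos hms
  have hN : levelNorm w m (s + 1) ≠ 0 := (monicOP_norm_pos hw.pos (by omega)).ne'
  have hN' : levelNorm w m s ≠ 0 := (monicOP_norm_pos hw.pos hms).ne'
  have hqn := monicOP_eval_ne_zero_right (z := (s + 1 : ℕ)) hw.pos (by omega : m + 1 ≤ s + 1)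
    (by push_cast; linarith)
  have hqs := monicOP_eval_ne_zero_right (z := s) hw.pos (by omega : m + 1 ≤ s + 1)
    (by push_cast; rfl)
  have hqs' := monicOP_eval_ne_zero_right (z := s) hw.pos hms (by linarith)
  have hpn : (monicOP (discreteFunctional w (s + 1)) (m + 1)).eval ((s + 1 : ℕ) : ℝ) =
      opRatio (discreteFunctional w (s + 1)) m (s + 1 : ℕ) *
        (monicOP (discreteFunctional w (s + 1)) m).eval ((s + 1 : ℕ) : ℝ) :=
    (div_mul_cancel₀ _ hqn).symm
  have hps : (monicOP (discreteFunctional w (s + 1)) (m + 1)).eval (s : ℝ) =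
      opRatio (discreteFunctional w (s + 1)) m s *
        (monicOP (discreteFunctional w (s + 1)) m).eval (s : ℝ) :=
    (div_mul_cancel₀ _ hqs).symm
  have hps' : seqH w m s =
      opRatio (discreteFunctional w s) m s * (monicOP (discreteFunctional w s) m).eval (s : ℝ) :=
    (div_mul_cancel₀ _ hqs').symm
  have hker := hw.kernel_kernel (by omega) hp hq hK s (s + 1)
  have hcn := hK.norm_mul_coeff hq (s + 1)
  have hcs := hK.norm_mul_coeff hq s
  have hcs' := hK'.norm_mul_coeff hq' s
  have hρ := reprKernel_succ hw.pos hms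
  have hρe := congrArg (eval (s : ℝ)) hρ
  have hρc := congrArg (fun r => coeff r m) hρ
  have hu := christoffelPoly_eval_succ hw hβ hc hms
  have hIII := (seqF_succ_identities hw hβ hms).2
  have hpear := hw.pearson s
  have hf : seqF w m (s + 1) * (opRatio (discreteFunctional w (s + 1)) m 0 -
      opRatio (discreteFunctional w (s + 1)) m (s + 1 : ℕ)) =
      (s + 1) * opRatio (discreteFunctional w (s + 1)) m 0 := by
    rw [seqF, div_mul_cancel₀ _ (by linarith)]; push_cast; rfl
  have hg : seqG w m s * opRatio (discreteFunctional w (s + 1)) m 0 =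
      -opRatio (discreteFunctional w (s + 1)) m s := by
    rw [seqG, neg_mul, div_mul_cancel₀ _ ht₀.ne]
  have hσ : β + (s : ℝ) ≠ 0 := by positivity
  have hn : (s : ℝ) + 1 ≠ 0 := by positivity
  have hws := (hw.pos s).ne'
  have hρ0 : 1 + w s * (reprKernel (discreteFunctional w s) (m + 1) s).eval (s : ℝ) ≠ 0 := by
    have := mul_nonneg (hw.pos s).le (reprKernel_diag_nonneg hw.pos hms s)
    positivity
  have hs1 : (s : ℝ) + 1 - 1 = s := by ring
  -- In lower-level terms the factors of t_s from h² and g² cancel; what remains is a Christoffel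
  -- value that `hu` moves to the upper level.
  have hfac : (1 + c * seqG w m s) / (seqE w m s * seqG w m s ^ 2) * seqH w m s ^ 2 =
      c * (β + s) * ((monicOP (discreteFunctional w s) m).eval (s : ℝ) / levelNorm w m s *
        ((monicOP (discreteFunctional w s) m).eval (s : ℝ) *
        (opRatio (discreteFunctional w s) m s - opRatio (discreteFunctional w s) m (-β)) /
          (β + s))) := by
    rw [hps', seqG_eq_lower hw hβ hc hms, seqE_eq_lower hw hβ hc hms]
    have h3 := hτb.ne
    have h5 := hτs.ne'
    have h6 := hc.ne'
    field_simp
    ring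
  rw [mul_right_comm, mul_assoc (w s / _), mul_assoc, hfac, ← hu]
  clear hfac
  simp only [eval_mul, eval_C, coeff_C_mul] at hρe hρc
  rw [hs1] at hker
  unfold levelNorm at *
  push_cast at *
  generalize seqG w m s = g at *
  generalize seqF w m (s + 1) = f at *
  generalize opRatio (discreteFunctional w (s + 1)) m 0 = t₀ at *
  generalize opRatio (discreteFunctional w (s + 1)) m (s + 1) = tn at *
  generalize opRatio (discreteFunctional w (s + 1)) m s = ts at *
  rw [hpn, hps] at hker
  generalize (monicOP (discreteFunctional w (s + 1)) m).eval ((s : ℝ) + 1) = qn at *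
  generalize (monicOP (discreteFunctional w (s + 1)) m).eval (s : ℝ) = qs at *
  generalize (monicOP (discreteFunctional w s) m).eval (s : ℝ) = qs' at *
  generalize (reprKernel (discreteFunctional w (s + 1)) (m + 1) (s + 1)).eval ((s : ℝ) + 1) = Kn at *
  generalize (reprKernel (discreteFunctional w (s + 1)) (m + 1) s).eval (s : ℝ) = Ks at *
  generalize (reprKernel (discreteFunctional w s) (m + 1) s).eval (s : ℝ) = Ks' at *
  generalize (reprKernel (discreteFunctional w (s + 1)) (m + 1) (s + 1)).coeff m = cn at *
  generalize (reprKernel (discreteFunctional w (s + 1)) (m + 1) s).coeff m = cs at *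
  generalize (reprKernel (discreteFunctional w s) (m + 1) s).coeff m = cs' at *
  generalize discreteFunctional w (s + 1) (monicOP (discreteFunctional w (s + 1)) m *
    monicOP (discreteFunctional w (s + 1)) m) = N at *
  generalize discreteFunctional w s (monicOP (discreteFunctional w s) m *
    monicOP (discreteFunctional w s) m) = N' at *
  -- the bracket in closed form
  have hbr : (tn - t₀) * ((1 + c * g) * f - s - 1) = -((s + 1) * (tn - c * ts)) := by
    linear_combination (-1 - c * g) * hf - c * (s + 1) * hg
  have hcs'' : qs' / N' = cs' := by rw [← hcs', mul_div_cancel_left₀ _ hN']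
  -- The relation `hker2` is multiplied by 1 + w(s)Ks', so that Ks and cs combine into the
  -- lower-level Ks' and cs'.
  have hmain : c * (β + s) * Kn - (s + 1) * Ks' = cs' * qn * (c * ts - tn) := by
    have hcn' : cn = qn / N := by rw [← hcn, mul_div_cancel_left₀ _ hN]
    have hqs2 : qs = N * cs := hcs.symm
    rw [hcn', hqs2] at hker
    have hker2 : c * ((β + s) * Kn - ts * cs * qn) = (s + 1) * Ks - tn * qn * cs +
        c * (β + s) * w s * Kn * Ks := by
      rw [← hpear]
      have : ts * (N * cs) * (qn / N) = ts * cs * qn := by field_simp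
      rw [this] at hker
      linear_combination hker
    linear_combination (1 + w s * Ks') * hker2 + (s + 1 + c * (β + s) * w s * Kn) * hρe +
      (c * ts - tn) * qn * hρc
  rw [hcs'']
  have hw1 : w (s + 1) = c * (β + s) * w s / (s + 1) := by
    rw [eq_div_iff hn, ← hpear]; ring
  rw [hw1]
  have h6 := hc.ne'
  field_simp
  linear_combination (s + 1) * hmain - cs' * qn * hbr
end GapRatio

/-! ### Finite differences when nodes and degree match. -/

section FiniteDifferences

open Polynomial Finset

/-- The `m`-th finite difference of a polynomial of degree at most `m`. -/
theorem sum_alternating_choose_mul_eval {m : ℕ} {f : ℝ[X]} (hf : f.degree < (m + 1 : ℕ)) :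
    ∑ i ∈ range (m + 1), (-1) ^ (m - i) * (m.choose i : ℝ) * f.eval (i : ℝ) =
      f.coeff m * (m ! : ℝ) := by
  have h := fwdDiff_iter_eq_sum_shift (1 : ℝ) f.eval m 0
  have h1 : ∑ i ∈ range (m + 1), (-1) ^ (m - i) * (m.choose i : ℝ) * f.eval (i : ℝ) =
      (fwdDiff (1 : ℝ))^[m] f.eval 0 := by
    rw [h]
    refine sum_congr rfl fun i _ => ?_
    simp
  rw [h1]
  have hle : f.natDegree ≤ m := by
    by_cases h0 : f = 0
    · simp [h0]
    · have := (natDegree_lt_iff_degree_lt h0).2 hf; omega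
  rcases hle.eq_or_lt with h2 | h2
  · subst h2
    rw [f.fwdDiff_iter_degree_eq_factorial]
    simp
  · rw [Polynomial.fwdDiff_iter_eq_zero_of_degree_lt h2, coeff_eq_zero_of_natDegree_lt h2]
    simp

theorem eq_zero_of_sum_mul_eval_eq_zero {n : ℕ} {a : ℕ → ℝ}
    (h : ∀ f : ℝ[X], f.degree < n → ∑ x ∈ range n, a x * f.eval (x : ℝ) = 0) {i : ℕ} (hi : i < n) :
    a i = 0 := by
  have hi' := mem_range.2 hi
  have hd : (∏ j ∈ (range n).erase i, (X - C (j : ℝ)) : ℝ[X]).degree < n := by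
    rw [degree_prod]
    simp only [degree_X_sub_C, sum_const, card_erase_of_mem hi', card_range]
    rw [nsmul_one]
    exact_mod_cast (by omega : n - 1 < n)
  have h1 := h _ hd
  rw [sum_eq_single i] at h1
  · refine (mul_eq_zero.1 h1).resolve_right ?_
    rw [eval_prod]
    refine prod_ne_zero_iff.2 fun j hj => ?_
    rw [eval_sub, eval_X, eval_C, sub_ne_zero]
    exact_mod_cast (ne_of_mem_erase hj).symm
  · intro j hj hji
    rw [eval_prod, prod_eq_zero (mem_erase.2 ⟨hji, hj⟩), mul_zero]
    simp
  · exact fun h => absurd hi' h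

/-- The norm of the last orthogonal polynomial on equispaced nodes. -/
theorem norm_mul_sum_choose_sq {w : ℕ → ℝ} {m : ℕ} (hw : ∀ x ≤ m, w x ≠ 0) {u : ℝ[X]}
    (hu : IsMonicOP (discreteFunctional w (m + 1)) m u) :
    discreteFunctional w (m + 1) (u * u) * ∑ i ∈ range (m + 1), (m.choose i : ℝ) ^ 2 / w i =
      (m ! : ℝ) ^ 2 := by
  set N := discreteFunctional w (m + 1) (u * u) with hN
  -- On m + 1 points both w u and the alternating binomials annihilate degrees below m, so they are
  -- proportional; the pairing with degree m fixes the constant.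
  have h1 : ∀ i ≤ m, w i * u.eval (i : ℝ) * (m ! : ℝ) = N * ((-1) ^ (m - i) * (m.choose i : ℝ)) := by
    intro i hi
    refine sub_eq_zero.1 (eq_zero_of_sum_mul_eval_eq_zero (n := m + 1)
      (a := fun i => w i * u.eval (i : ℝ) * (m ! : ℝ) - N * ((-1) ^ (m - i) * (m.choose i : ℝ)))
      (fun f hf => ?_) (by omega))
    have h2 := sum_alternating_choose_mul_eval hf
    have h3 := hu.map_mul hf
    rw [discreteFunctional_apply] at h3
    have h4 : ∀ x ∈ range (m + 1), (w x * u.eval (x : ℝ) * (m ! : ℝ) -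
        N * ((-1) ^ (m - x) * (m.choose x : ℝ))) * f.eval (x : ℝ) =
        (m ! : ℝ) * (w x * (u * f).eval (x : ℝ)) -
          N * ((-1) ^ (m - x) * (m.choose x : ℝ) * f.eval (x : ℝ)) := fun x _ => by
      rw [eval_mul]; ring
    rw [sum_congr rfl h4, sum_sub_distrib, ← mul_sum, ← mul_sum, h2, h3]
    ring
  have h5 := sum_alternating_choose_mul_eval hu.degree_lt
  rw [hu.coeff_self, one_mul] at h5
  rw [pow_two (m ! : ℝ)]
  nth_rewrite 1 [← h5]
  rw [mul_sum, sum_mul]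
  refine sum_congr rfl fun i hi => ?_
  have hi' : i ≤ m := by have := mem_range.1 hi; omega
  have h6 := hw i hi'
  rw [mul_div_assoc', div_eq_iff h6]
  have h7 : ((-1 : ℝ) ^ (m - i)) ^ 2 = 1 := by rw [← pow_mul, mul_comm, pow_mul]; simp
  linear_combination -((-1) ^ (m - i) * (m.choose i : ℝ)) * h1 i hi' - N * (m.choose i : ℝ) ^ 2 * h7

/-- The reproducing kernel on as many nodes as its rank, at the next node. -/
theorem reprKernel_eval_next {w : ℕ → ℝ} (hw : ∀ x, 0 < w x) {k : ℕ} :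
    (reprKernel (discreteFunctional w k) k k).eval (k : ℝ) =
      ∑ i ∈ range k, (k.choose i : ℝ) ^ 2 / w i := by
  have hK := isReproducing_reprKernel (momentDefinite_discreteFunctional hw (le_refl k))
  -- The k-th difference of f vanishes, so f(k) is extrapolated from 0, …, k - 1; these coefficients
  -- must be the weighted kernel values.
  have hd : ∀ f : ℝ[X], f.degree < k →
      f.eval (k : ℝ) = -∑ i ∈ range k, (-1) ^ (k - i) * (k.choose i : ℝ) * f.eval (i : ℝ) := by
    intro f hf
    have h := sum_alternating_choose_mul_eval (hf.trans (by exact_mod_cast k.lt_succ_self))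
    rw [sum_range_succ, (degree_lt_iff_coeff_zero _ _).1 hf k le_rfl] at h
    simp only [tsub_self, pow_zero, Nat.choose_self, Nat.cast_one, one_mul, zero_mul] at h
    linarith
  have h1 : ∀ i < k, w i * (reprKernel (discreteFunctional w k) k k).eval (i : ℝ) =
      -((-1) ^ (k - i) * (k.choose i : ℝ)) := by
    intro i hi
    refine eq_neg_of_add_eq_zero_left (eq_zero_of_sum_mul_eval_eq_zero (n := k)
      (a := fun i => w i * (reprKernel (discreteFunctional w k) k k).eval (i : ℝ) +
        (-1) ^ (k - i) * (k.choose i : ℝ)) (fun f hf => ?_) hi)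
    have h2 := hd f hf
    have h3 := hK.repr k f hf
    rw [discreteFunctional_apply] at h3
    rw [← h3] at h2
    simp only [add_mul, sum_add_distrib]
    simp only [eval_mul, ← mul_assoc] at h2
    linarith
  rw [hd _ (hK.degree_lt _), ← sum_neg_distrib]
  refine sum_congr rfl fun i hi => ?_
  have h2 := h1 i (mem_range.1 hi)
  rw [eq_div_iff (hw i).ne']
  have h7 : ((-1 : ℝ) ^ (k - i)) ^ 2 = 1 := by rw [← pow_mul, mul_comm, pow_mul]; simp
  linear_combination -((-1) ^ (k - i) * (k.choose i : ℝ)) * h2 + (k.choose i : ℝ) ^ 2 * h7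

end FiniteDifferences

/-! ### The level with m + 1 nodes. -/

section FirstLevel

open Polynomial Matrix

/-- The moment matrix factors as VᵀWV with V the Vandermonde matrix of 0, …, m, whose determinant is
a superfactorial. -/
theorem det_momentMatrix_self (w : ℕ → ℝ) (m : ℕ) :
    (momentMatrix (discreteFunctional w (m + 1)) (m + 1)).det =
      ∏ x ∈ Finset.range (m + 1), w x * (x ! : ℝ) ^ 2 := by
  have h : momentMatrix (discreteFunctional w (m + 1)) (m + 1) =
      (vandermonde fun i : Fin (m + 1) => ((i : ℕ) : ℝ))ᵀ * diagonal (fun i : Fin (m + 1) => w i) *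
        vandermonde fun i : Fin (m + 1) => ((i : ℕ) : ℝ) := by
    ext i j
    rw [mul_apply]
    simp only [momentMatrix, of_apply, discreteFunctional_apply, mul_diagonal, transpose_apply, vandermonde_apply, eval_pow, eval_X]
    rw [← Fin.sum_univ_eq_sum_range (fun x : ℕ => w x * (x : ℝ) ^ ((i : ℕ) + j))]
    refine Finset.sum_congr rfl fun x _ => ?_
    rw [pow_add]; ring
  have hs : ∀ n : ℕ, (n.superFactorial : ℝ) = ∏ x ∈ Finset.range (n + 1), (x ! : ℝ) := by
    intro n
    induction n with
    | zero => simp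
    | succ n ih => rw [Finset.prod_range_succ, ← ih, Nat.superFactorial]; push_cast; ring
  rw [h, det_mul, det_mul, det_transpose, det_diagonal, det_vandermonde_id_eq_superFactorial, hs,
    Finset.prod_mul_distrib, Finset.prod_pow, ← Fin.prod_univ_eq_prod_range w]
  ring

theorem monicOP_self {w : ℕ → ℝ} (hw : ∀ x, 0 < w x) (k : ℕ) :
    monicOP (discreteFunctional w k) k = ∏ x ∈ Finset.range k, (X - C (x : ℝ)) := by
  have hL := momentDefinite_discreteFunctional hw (le_refl k)
  refine (isMonicOP_monicOP hL).unique hL ⟨monic_prod_X_sub_C _ _, by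
    rw [natDegree_finsetProd_X_sub_C_eq_card, Finset.card_range], fun f _ => ?_⟩
  rw [discreteFunctional_apply]
  refine Finset.sum_eq_zero fun x hx => ?_
  rw [eval_mul, eval_prod, Finset.prod_eq_zero hx (by simp)]
  ring

variable {w : ℕ → ℝ} {m : ℕ}

theorem seqF_first (hw : ∀ x, 0 < w x) : seqF w m (m + 1) = 0 := by
  have : opRatio (discreteFunctional w (m + 1)) m 0 = 0 := by
    rw [opRatio, monicOP_self hw, eval_prod, Finset.prod_eq_zero (Finset.mem_range.2 m.succ_pos)]
    · simp
    · simp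
  rw [seqF, this]; simp

theorem seqH_first (hw : ∀ x, 0 < w x) : seqH w m (m + 1) = ((m + 1)! : ℝ) := by
  rw [seqH, monicOP_self hw, eval_prod]
  simp only [eval_sub, eval_X, eval_C]
  generalize m + 1 = k
  have : ∀ x ∈ Finset.range k, ((k : ℝ) - x) = ((k - x : ℕ) : ℝ) := fun x hx => by
    rw [Nat.cast_sub (Finset.mem_range.1 hx).le]
  rw [Finset.prod_congr rfl this, ← Nat.cast_prod, ← Finset.prod_range_reflect]
  congr 1
  rw [← Finset.prod_range_add_one_eq_factorial]
  exact Finset.prod_congr rfl fun x hx => by have := Finset.mem_range.1 hx; omega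

theorem christoffelFunctional_discrete (w : ℕ → ℝ) (n : ℕ) (z : ℝ) :
    christoffelFunctional (discreteFunctional w n) z =
      discreteFunctional (fun x => (x - z) * w x) n := by
  refine LinearMap.ext fun f => ?_
  rw [christoffelFunctional_apply, discreteFunctional_apply, discreteFunctional_apply]
  refine Finset.sum_congr rfl fun x _ => ?_
  rw [eval_mul, eval_sub, eval_X, eval_C]; ring

theorem levelNorm_mul_opRatio_first (hw : ∀ x, 0 < w x) {z : ℝ}
    (hz : (monicOP (discreteFunctional w (m + 1)) m).eval z ≠ 0) (hz' : ∀ x ≤ m, (x : ℝ) ≠ z) :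
    levelNorm w m (m + 1) * opRatio (discreteFunctional w (m + 1)) m z *
      ∑ i ∈ Finset.range (m + 1), (m.choose i : ℝ) ^ 2 / ((z - i) * w i) = (m ! : ℝ) ^ 2 := by
  have hL := momentDefinite_discreteFunctional hw (le_refl (m + 1))
  have hu := isMonicOP_christoffelPoly hL hz
  have h1 := christoffelFunctional_christoffelPoly_mul_self hL hz
  rw [christoffelFunctional_discrete] at hu h1
  -- The transformed weight (x - z)w(x) can be negative; only its nonvanishing matters here.
  have h2 := norm_mul_sum_choose_sq
    (fun x hx => mul_ne_zero (sub_ne_zero.2 (hz' x hx)) (hw x).ne') hu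
  rw [h1] at h2
  rw [← h2, levelNorm, mul_comm (opRatio _ _ _), neg_mul, ← mul_neg, ← Finset.sum_neg_distrib]
  congr 1
  refine Finset.sum_congr rfl fun i _ => ?_
  rw [← div_neg, ← neg_mul, neg_sub]

end FirstLevel

/-! ### Pochhammer symbols and terminating hypergeometric sums. -/

section Pochhammer

theorem poch_zero (a : ℝ) : poch a 0 = 1 := by simp [poch]

theorem poch_succ (a : ℝ) (n : ℕ) : poch a (n + 1) = poch a n * (a + n) := by
  simp [poch, ascPochhammer_succ_eval]

theorem poch_pos {a : ℝ} (ha : 0 < a) (n : ℕ) : 0 < poch a n := ascPochhammer_pos n a ha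

theorem poch_add (a : ℝ) (n j : ℕ) : poch a (n + j) = poch a n * poch (a + n) j := by
  induction j with
  | zero => simp [poch_zero]
  | succ j ih => rw [← add_assoc, poch_succ, poch_succ, ih]; push_cast; ring

theorem poch_neg_nat (n j : ℕ) : poch (-(n : ℝ)) j = (-1) ^ j * (n.descFactorial j : ℝ) := by
  induction j with
  | zero => simp [poch_zero]
  | succ j ih =>
    rw [poch_succ, ih, Nat.descFactorial_succ]
    rcases le_or_gt j n with h | h
    · push_cast [h]; ring
    · rw [Nat.descFactorial_of_lt h]; simp

theorem poch_neg_nat_eq_choose (n j : ℕ) :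
    poch (-(n : ℝ)) j = (-1) ^ j * ((j ! : ℝ) * (n.choose j : ℝ)) := by
  rw [poch_neg_nat, Nat.descFactorial_eq_factorial_mul_choose]; push_cast; ring

/-- The binomial series. -/
theorem hasSum_poch (a : ℝ) {c : ℝ} (hc0 : 0 < c) (hc1 : c < 1) :
    HasSum (fun n : ℕ => poch a n / (n ! : ℝ) * c ^ n) ((1 - c) ^ (-a)) := by
  have h := (Real.one_div_one_sub_rpow_hasFPowerSeriesOnBall_zero a).hasSum (y := c) (by
    rw [Metric.mem_eball, edist_dist]
    simp only [dist_zero_right, Real.norm_eq_abs, abs_of_pos hc0]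
    rw [← ENNReal.ofReal_one]
    exact (ENNReal.ofReal_lt_ofReal_iff one_pos).2 hc1)
  rw [zero_add, one_div, ← Real.rpow_neg (by linarith)] at h
  refine (congrArg (fun f => HasSum f _) (funext fun n => ?_)).mp h
  rw [FormalMultilinearSeries.ofScalars_apply_eq, smul_eq_mul, ← Ring.multichoose_eq]
  have h1 := Ring.factorial_nsmul_multichoose_eq_ascPochhammer a n
  rw [Polynomial.ascPochhammer_smeval_cast, Polynomial.ascPochhammer_smeval_eq_eval,
    nsmul_eq_mul] at h1
  rw [poch, ← h1]
  field_simp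

theorem hypergeometric_neg_nat (n : ℕ) (b d z : ℝ) : ₂F₁ (-(n : ℝ)) b d z =
    ∑ j ∈ Finset.range (n + 1),
      ((j ! : ℝ)⁻¹ * poch (-(n : ℝ)) j * poch b j * (poch d j)⁻¹) * z ^ j := by
  rw [ordinaryHypergeometric_eq_tsum]
  refine (tsum_eq_sum (s := Finset.range (n + 1)) fun j hj => ?_).trans ?_
  · have : poch (-(n : ℝ)) j = 0 := by
      rw [poch_neg_nat, Nat.descFactorial_of_lt (by simpa using hj)]; simp
    unfold poch at this
    rw [this]; simp
  · rfl

theorem hypergeometric_neg_nat_neg_nat (n n' : ℕ) (d z : ℝ) : ₂F₁ (-(n : ℝ)) (-(n' : ℝ)) d z =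
    ∑ j ∈ Finset.range (n + 1),
      (n.choose j : ℝ) * (n'.choose j : ℝ) * (j ! : ℝ) / poch d j * z ^ j := by
  rw [hypergeometric_neg_nat]
  refine Finset.sum_congr rfl fun j _ => ?_
  rw [poch_neg_nat_eq_choose, poch_neg_nat_eq_choose]
  have h : ((-1 : ℝ) ^ j) ^ 2 = 1 := by rw [← pow_mul, mul_comm, pow_mul]; simp
  have hj : (j ! : ℝ) ≠ 0 := by positivity
  field_simp
  linear_combination (n.choose j : ℝ) * (n'.choose j : ℝ) * (z ^ j) / poch d j * h

end Pochhammer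

/-! ### Orthogonality and norms of the Meixner polynomials. -/

section MeixnerPolynomials

open Polynomial

theorem meixnerWeight_pos {β c : ℝ} (hβ : 0 < β) (hc : 0 < c) (x : ℕ) : 0 < meixnerWeight β c x := by
  have := poch_pos hβ x
  unfold meixnerWeight
  positivity

theorem isPearsonWeight_meixnerWeight {β c : ℝ} (hβ : 0 < β) (hc : 0 < c) :
    IsPearsonWeight β c (meixnerWeight β c) where
  pos := meixnerWeight_pos hβ hc
  pearson x := by
    unfold meixnerWeight
    rw [poch_succ, Nat.factorial_succ, pow_succ]
    push_cast
    field_simp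

variable {β c : ℝ}

/-- The factor (-x)_j kills the terms x < j; the rest is the binomial series with exponent -(β + i +
j). -/
theorem hasSum_meixnerWeight_mul (hc0 : 0 < c) (hc1 : c < 1) (i j : ℕ) :
    HasSum (fun x : ℕ => meixnerWeight β c x * (poch (-(x : ℝ)) j * poch (β + x) i))
      ((-1) ^ j * c ^ j * poch β (i + j) * (1 - c) ^ (-(β + (i + j : ℕ)))) := by
  have h := (hasSum_poch (β + (i + j : ℕ)) hc0 hc1).mul_left ((-1) ^ j * c ^ j * poch β (i + j))
  have h0 : ∑ x ∈ Finset.range j,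
      meixnerWeight β c x * (poch (-(x : ℝ)) j * poch (β + x) i) = 0 :=
    Finset.sum_eq_zero fun x hx => by
      rw [poch_neg_nat, Nat.descFactorial_of_lt (Finset.mem_range.1 hx)]; simp
  rw [← add_zero (_ * _), ← h0, ← hasSum_nat_add_iff j]
  refine (congrArg (fun f => HasSum f _) (funext fun y => ?_)).mp h
  have h1 : poch β (y + j) * poch (β + (y + j : ℕ)) i =
      poch β (i + j) * poch (β + (i + j : ℕ)) y := by
    rw [← poch_add, ← poch_add]; congr 1; omega
  have h2 : ((y + j) ! : ℝ) = y ! * ((y + j).descFactorial j : ℝ) := by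
    have := Nat.factorial_mul_descFactorial (Nat.le_add_left j y)
    rw [Nat.add_sub_cancel] at this
    exact_mod_cast this.symm
  have h3 : ((y + j).descFactorial j : ℝ) ≠ 0 := by
    have := Nat.descFactorial_pos.2 (Nat.le_add_left j y)
    positivity
  rw [poch_neg_nat, meixnerWeight, h2, pow_add]
  have h4 : (y ! : ℝ) ≠ 0 := by positivity
  field_simp
  linear_combination -h1

theorem pow_le_poch_add {b x : ℝ} (hb : 0 ≤ b) (hx : 0 ≤ x) (j : ℕ) : x ^ j ≤ poch (b + x) j := by
  induction j with
  | zero => simp [poch_zero]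
  | succ j ih =>
    rw [poch_succ, pow_succ]
    have : (0 : ℝ) ≤ j := j.cast_nonneg
    exact mul_le_mul ih (by linarith) hx ((pow_nonneg hx j).trans ih)

theorem summable_meixnerWeight_mul_eval (hβ : 0 < β) (hc0 : 0 < c) (hc1 : c < 1) (f : ℝ[X]) :
    Summable fun x : ℕ => meixnerWeight β c x * f.eval (x : ℝ) := by
  induction f using Polynomial.induction_on' with
  | add p q hp hq => simpa [mul_add] using hp.add hq
  | monomial j a =>
    have h := (hasSum_meixnerWeight_mul (β := β) hc0 hc1 j 0).summable
    simp only [poch_zero, one_mul] at h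
    have h2 : Summable fun x : ℕ => meixnerWeight β c x * (x : ℝ) ^ j := by
      refine h.of_nonneg_of_le (fun x => mul_nonneg (meixnerWeight_pos hβ hc0 x).le (by positivity))
        fun x => mul_le_mul_of_nonneg_left ?_ (meixnerWeight_pos hβ hc0 x).le
      exact pow_le_poch_add hβ.le x.cast_nonneg j
    simpa [mul_left_comm] using h2.mul_left a

/-- Integration of polynomials against a weight all of whose moments converge. -/
noncomputable def seriesFunctional (w : ℕ → ℝ)
    (hw : ∀ f : ℝ[X], Summable fun x : ℕ => w x * f.eval (x : ℝ)) : ℝ[X] →ₗ[ℝ] ℝ where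
  toFun f := ∑' x : ℕ, w x * f.eval (x : ℝ)
  map_add' f g := by
    rw [← (hw f).tsum_add (hw g)]
    simp [mul_add]
  map_smul' a f := by
    simp [← tsum_mul_left, mul_left_comm]

theorem seriesFunctional_apply {w : ℕ → ℝ}
    (hw : ∀ f : ℝ[X], Summable fun x : ℕ => w x * f.eval (x : ℝ)) (f : ℝ[X]) :
    seriesFunctional w hw f = ∑' x : ℕ, w x * f.eval (x : ℝ) := rfl

theorem momentDefinite_seriesFunctional {w : ℕ → ℝ}
    (hw : ∀ f : ℝ[X], Summable fun x : ℕ => w x * f.eval (x : ℝ)) (hpos : ∀ x, 0 < w x) (k : ℕ) :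
    MomentDefinite (seriesFunctional w hw) k := by
  intro r hr h
  have hnn : ∀ x : ℕ, 0 ≤ w x * (r * r).eval (x : ℝ) := fun x => by
    rw [eval_mul]; exact mul_nonneg (hpos x).le (mul_self_nonneg _)
  rw [seriesFunctional_apply] at h
  have h0 := (hasSum_zero_iff_of_nonneg hnn).1 (h ▸ (hw (r * r)).hasSum)
  refine eq_zero_of_eval_range_eq_zero hr (Finset.range k) (by simp) fun x _ => ?_
  have := congrFun h0 x
  simpa [eval_mul, (hpos x).ne'] using this

/-- The monic Meixner polynomial, as a polynomial. -/
noncomputable def meixnerPoly (β c : ℝ) (n : ℕ) : ℝ[X] :=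
  ∑ j ∈ Finset.range (n + 1), C (poch β n * ((1 - 1 / c) ^ n)⁻¹ *
    ((-1) ^ j * (n.choose j : ℝ) * (poch β j)⁻¹ * (1 - 1 / c) ^ j)) *
      (ascPochhammer ℝ j).comp (C (-1) * X)

theorem eval_meixnerPoly (β c : ℝ) (n : ℕ) (ζ : ℝ) :
    (meixnerPoly β c n).eval ζ = monicMeixner β c n ζ := by
  rw [monicMeixner, meixner, hypergeometric_neg_nat, meixnerPoly, eval_finsetSum, Finset.mul_sum]
  refine Finset.sum_congr rfl fun j _ => ?_
  have h : ((ascPochhammer ℝ j).comp (C (-1) * X)).eval ζ = poch (-ζ) j := by simp [poch]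
  rw [eval_mul, h, eval_C, poch_neg_nat_eq_choose]
  have hj : (j ! : ℝ) ≠ 0 := by positivity
  field_simp

theorem monic_meixnerPoly (hβ : 0 < β) (hc0 : 0 < c) (hc1 : c < 1) (n : ℕ) :
    (meixnerPoly β c n).natDegree ≤ n ∧ (meixnerPoly β c n).coeff n = 1 := by
  constructor
  · refine natDegree_sum_le_of_forall_le _ _ fun j hj => (natDegree_C_mul_le _ _).trans ?_
    rw [natDegree_comp, ascPochhammer_natDegree, natDegree_C_mul_X _ (by norm_num)]
    have := Finset.mem_range.1 hj
    omega
  · have h1 : (1 - 1 / c) ≠ 0 := by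
      have : 1 < 1 / c := by rw [lt_div_iff₀ hc0]; linarith
      linarith
    have h2 := (poch_pos hβ n).ne'
    rw [meixnerPoly, finsetSum_coeff, Finset.sum_range_succ, Finset.sum_eq_zero, zero_add, coeff_C_mul,
      comp_C_mul_X_coeff]
    · have h3 : (ascPochhammer ℝ n).coeff n = 1 := by
        have := (monic_ascPochhammer ℝ n).coeff_natDegree
        rwa [ascPochhammer_natDegree] at this
      rw [h3, Nat.choose_self]
      have h : ((-1 : ℝ) ^ n) * (-1) ^ n = 1 := by rw [← mul_pow]; simp
      calc _ = (poch β n * (poch β n)⁻¹) * (((1 - 1 / c) ^ n)⁻¹ * (1 - 1 / c) ^ n) *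
            ((-1) ^ n * (-1) ^ n) := by push_cast; ring
        _ = 1 := by rw [h, mul_inv_cancel₀ h2, inv_mul_cancel₀ (pow_ne_zero n h1)]; norm_num
    · intro j hj
      rw [coeff_C_mul, comp_C_mul_X_coeff, coeff_eq_zero_of_natDegree_lt, zero_mul, mul_zero]
      rw [ascPochhammer_natDegree]
      exact Finset.mem_range.1 hj

/-- The moment functional of the Meixner weight. -/
noncomputable def meixnerFunctional (hβ : 0 < β) (hc0 : 0 < c) (hc1 : c < 1) : ℝ[X] →ₗ[ℝ] ℝ :=
  seriesFunctional (meixnerWeight β c) (summable_meixnerWeight_mul_eval hβ hc0 hc1)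

/-- Expanding the Meixner polynomial in (-X)_j and pairing with (X + β)_i makes every moment
explicit. The sum over j becomes the n-th finite difference of (x + β)_i, which vanishes for i < n
and reads off the leading coefficient for i = n. -/
theorem meixnerFunctional_meixnerPoly_mul (hβ : 0 < β) (hc0 : 0 < c) (hc1 : c < 1) {i n : ℕ}
    (hi : i ≤ n) : meixnerFunctional hβ hc0 hc1
      (meixnerPoly β c n * (ascPochhammer ℝ i).comp (X + C β)) =
      if i = n then n ! * poch β n * c ^ n * (1 - c) ^ (-(β + 2 * n)) else 0 := by
  have hbasis : ∀ j, meixnerFunctional hβ hc0 hc1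
      ((ascPochhammer ℝ j).comp (C (-1) * X) * (ascPochhammer ℝ i).comp (X + C β)) =
      (-1) ^ j * c ^ j * poch β (i + j) * (1 - c) ^ (-(β + (i + j : ℕ))) := fun j => by
    rw [meixnerFunctional, seriesFunctional_apply, ← (hasSum_meixnerWeight_mul hc0 hc1 i j).tsum_eq]
    refine tsum_congr fun x => ?_
    simp [poch, add_comm]
  have hlt : (0 : ℝ) < 1 - c := by linarith
  have hterm : ∀ j, (1 - 1 / c) ^ j * (c ^ j * (1 - c) ^ (-(β + (i + j : ℕ)))) =
      (-1) ^ j * (1 - c) ^ (-(β + i)) := fun j => by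
    have h1 : -(β + (i + j : ℕ)) = -(β + i) - (j : ℝ) := by push_cast; ring
    rw [h1, Real.rpow_sub hlt, Real.rpow_natCast, ← mul_assoc, ← mul_pow, ← mul_div_assoc,
      mul_comm _ ((1 - c) ^ (-(β + i))), mul_div_assoc, ← div_pow, mul_comm]
    congr 2
    field_simp
    ring
  have hdeg : ((ascPochhammer ℝ i).comp (X + C β)).natDegree = i := by
    rw [natDegree_comp, ascPochhammer_natDegree, natDegree_X_add_C, mul_one]
  have hmon : ((ascPochhammer ℝ i).comp (X + C β)).Monic := (monic_ascPochhammer ℝ i).comp_X_add_C β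
  have hfd := sum_alternating_choose_mul_eval (m := n) (f := (ascPochhammer ℝ i).comp (X + C β)) (by
    rw [degree_eq_natDegree hmon.ne_zero, hdeg]; exact_mod_cast Nat.lt_succ_of_le hi)
  have hsum : meixnerFunctional hβ hc0 hc1
      (meixnerPoly β c n * (ascPochhammer ℝ i).comp (X + C β)) =
      poch β n * ((1 - 1 / c) ^ n)⁻¹ * (1 - c) ^ (-(β + i)) * (-1) ^ n *
        (((ascPochhammer ℝ i).comp (X + C β)).coeff n * n !) := by
    rw [← hfd, meixnerPoly, Finset.sum_mul, map_sum, Finset.mul_sum]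
    refine Finset.sum_congr rfl fun j hj => ?_
    have hjn : j ≤ n := Nat.lt_succ_iff.1 (Finset.mem_range.1 hj)
    have hev : ((ascPochhammer ℝ i).comp (X + C β)).eval (j : ℝ) = poch (β + j) i := by
      simp [poch, add_comm]
    have hpj := (poch_pos hβ j).ne'
    have hp : poch β (i + j) = poch β j * poch (β + j) i := by rw [← poch_add, add_comm]
    have hs : (-1 : ℝ) ^ n * (-1) ^ (n - j) = (-1) ^ j := by
      obtain ⟨d, rfl⟩ := Nat.exists_eq_add_of_le hjn
      rw [Nat.add_sub_cancel_left, pow_add, mul_assoc, ← mul_pow]; simp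
    have hs2 : (-1 : ℝ) ^ j * (-1) ^ j = 1 := by rw [← mul_pow]; simp
    rw [mul_assoc, map_C_mul, hbasis, hev, hp]
    calc _ = poch β n * ((1 - 1 / c) ^ n)⁻¹ * (n.choose j : ℝ) * poch (β + j) i *
          ((-1) ^ j * (-1) ^ j) * ((poch β j)⁻¹ * poch β j) *
          ((1 - 1 / c) ^ j * (c ^ j * (1 - c) ^ (-(β + (i + j : ℕ))))) := by ring
      _ = _ := by
        rw [hterm, hs2, inv_mul_cancel₀ hpj, ← hs]; ring
  rw [hsum]
  split_ifs with h
  · subst h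
    have h1 : ((ascPochhammer ℝ i).comp (X + C β)).coeff i = 1 := by
      have := hmon.coeff_natDegree
      rwa [hdeg] at this
    have h2 : -(β + 2 * i) = -(β + i) - (i : ℝ) := by ring
    rw [h1, h2, Real.rpow_sub hlt, Real.rpow_natCast, ← inv_pow]
    have h3 : (1 - 1 / c)⁻¹ = -1 * (c * (1 - c)⁻¹) := by
      have : (1 - 1 / c) = -((1 - c) / c) := by field_simp; ring
      rw [this, inv_neg, inv_div]; field_simp
    rw [h3, mul_pow, mul_pow, inv_pow]
    have hs2 : ((-1 : ℝ) ^ i) * (-1) ^ i = 1 := by rw [← mul_pow]; simp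
    linear_combination (poch β i * c ^ i * ((1 - c) ^ i)⁻¹ * (1 - c) ^ (-(β + i)) * i !) * hs2
  · rw [coeff_eq_zero_of_natDegree_lt (by omega)]; simp

theorem isMonicOP_meixnerPoly (hβ : 0 < β) (hc0 : 0 < c) (hc1 : c < 1) (n : ℕ) :
    IsMonicOP (meixnerFunctional hβ hc0 hc1) n (meixnerPoly β c n) := by
  obtain ⟨h1, h2⟩ := monic_meixnerPoly hβ hc0 hc1 n
  refine ⟨monic_of_natDegree_le_of_coeff_eq_one n h1 h2,
    natDegree_eq_of_le_of_coeff_ne_zero h1 (by rw [h2]; exact one_ne_zero), ?_⟩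
  -- Induction on the degree bound of f, removing its top term with (X + β)_d.
  suffices h : ∀ d ≤ n, ∀ f : ℝ[X], f.degree < d →
      meixnerFunctional hβ hc0 hc1 (meixnerPoly β c n * f) = 0 from h n le_rfl
  intro d
  induction d with
  | zero =>
    intro _ f hf
    have : f = 0 := degree_eq_bot.1 (by simpa [Nat.WithBot.lt_zero_iff] using hf)
    rw [this, mul_zero, map_zero]
  | succ d ih =>
    intro hd f hf
    have hdeg : ((ascPochhammer ℝ d).comp (X + C β)).natDegree = d := by
      rw [natDegree_comp, ascPochhammer_natDegree, natDegree_X_add_C, mul_one]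
    have h := ih (by omega) _
      (degree_sub_smul_lt ((monic_ascPochhammer ℝ d).comp_X_add_C β) hdeg hf)
    rw [mul_sub, map_sub, mul_left_comm, map_C_mul,
      meixnerFunctional_meixnerPoly_mul hβ hc0 hc1 (by omega), if_neg (by omega), mul_zero,
      sub_zero] at h
    exact h

theorem meixnerFunctional_meixnerPoly_mul_self (hβ : 0 < β) (hc0 : 0 < c) (hc1 : c < 1) (n : ℕ) :
    meixnerFunctional hβ hc0 hc1 (meixnerPoly β c n * meixnerPoly β c n) =
      n ! * poch β n * c ^ n * (1 - c) ^ (-(β + 2 * n)) := by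
  have hmon : ((ascPochhammer ℝ n).comp (X + C β)).Monic := (monic_ascPochhammer ℝ n).comp_X_add_C β
  have hdeg : ((ascPochhammer ℝ n).comp (X + C β)).natDegree = n := by
    rw [natDegree_comp, ascPochhammer_natDegree, natDegree_X_add_C, mul_one]
  have h := (isMonicOP_meixnerPoly hβ hc0 hc1 n).map_mul
    (f := (ascPochhammer ℝ n).comp (X + C β)) (by
      rw [degree_eq_natDegree hmon.ne_zero, hdeg]; exact_mod_cast n.lt_succ_self)
  rw [meixnerFunctional_meixnerPoly_mul hβ hc0 hc1 le_rfl, if_pos rfl] at h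
  have h1 := hmon.coeff_natDegree
  rw [hdeg] at h1
  rw [h, h1, one_mul]

theorem meixnerNormSq_eq_functional (hβ : 0 < β) (hc0 : 0 < c) (hc1 : c < 1) (n : ℕ) :
    meixnerNormSq β c n =
      meixnerFunctional hβ hc0 hc1 (meixnerPoly β c n * meixnerPoly β c n) := by
  rw [meixnerNormSq, meixnerFunctional, seriesFunctional_apply]
  refine tsum_congr fun x => ?_
  rw [eval_mul, eval_meixnerPoly]; ring

theorem meixnerNormSq_eq (hβ : 0 < β) (hc0 : 0 < c) (hc1 : c < 1) (n : ℕ) :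
    meixnerNormSq β c n = n ! * poch β n * c ^ n * (1 - c) ^ (-(β + 2 * n)) := by
  rw [meixnerNormSq_eq_functional hβ hc0 hc1, meixnerFunctional_meixnerPoly_mul_self]

theorem meixnerNormSq_pos (hβ : 0 < β) (hc0 : 0 < c) (hc1 : c < 1) (n : ℕ) :
    0 < meixnerNormSq β c n := by
  have h1 : (0 : ℝ) < 1 - c := by linarith
  have h2 := poch_pos hβ n
  rw [meixnerNormSq_eq hβ hc0 hc1]
  positivity

end MeixnerPolynomials

/-! ### The Christoffel–Darboux kernel and its gap determinants. -/

section MeixnerDeterminant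

open Polynomial Matrix

theorem isReproducing_sum_monicOP {L : ℝ[X] →ₗ[ℝ] ℝ} {p : ℕ → ℝ[X]} (hp : ∀ j, IsMonicOP L j (p j))
    (hN : ∀ j, L (p j * p j) ≠ 0) (k : ℕ) : IsReproducing L k
      (fun z => ∑ j ∈ Finset.range k, C ((p j).eval z / L (p j * p j)) * p j) := by
  have hdeg : ∀ k z, (∑ j ∈ Finset.range k, C ((p j).eval z / L (p j * p j)) * p j).degree <
      (k : WithBot ℕ) := fun k z => by
    refine (degree_sum_le _ _).trans_lt ((Finset.sup_lt_iff (WithBot.bot_lt_coe k)).2 fun j hj => ?_)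
    rw [← smul_eq_C_mul]
    refine (degree_smul_le _ _).trans_lt ?_
    rw [(hp j).degree_eq]
    exact Nat.cast_lt.2 (Finset.mem_range.1 hj)
  refine ⟨hdeg k, fun z => ?_⟩
  induction k with
  | zero =>
    intro f hf
    have : f = 0 := degree_eq_bot.1 (by simpa [Nat.WithBot.lt_zero_iff] using hf)
    simp [this]
  | succ k ih =>
    intro f hf
    have hr := degree_sub_smul_lt (hp k).monic (hp k).natDegree_eq hf
    obtain ⟨r, hr'⟩ : ∃ r, r = f - C (f.coeff k) * p k := ⟨_, rfl⟩
    rw [← hr'] at hr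
    have hf' : f = C (f.coeff k) * p k + r := by rw [hr']; ring
    obtain ⟨a, ha⟩ : ∃ a, a = f.coeff k := ⟨_, rfl⟩
    rw [← ha] at hf'
    have h1 := (hp k).orth _ (hdeg k z)
    have h2 := (hp k).orth r hr
    have h3 := ih r hr
    rw [Finset.sum_range_succ, hf']
    set R := ∑ j ∈ Finset.range k, C ((p j).eval z / L (p j * p j)) * p j
    set b := (p k).eval z / L (p k * p k) with hb
    have : (R + C b * p k) * (C a * p k + r) =
        C a * (p k * R) + R * r + C b * (C a * (p k * p k)) + C b * (p k * r) := by ring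
    rw [this]
    simp only [map_add, map_C_mul, h1, h2, h3, eval_add, eval_mul, eval_C, hb]
    have := hN k
    field_simp
    ring

/-- The change of basis from monomials to monic polynomials is unitriangular. -/
theorem det_map_mul_eq_det_momentMatrix {L : ℝ[X] →ₗ[ℝ] ℝ} {k : ℕ} {p : ℕ → ℝ[X]}
    (hp : ∀ j, (p j).Monic) (hd : ∀ j, (p j).natDegree = j) :
    (Matrix.of fun i j : Fin k => L (p i * p j)).det = (momentMatrix L k).det := by
  have hT := det_matrixOfPolynomials (fun i : Fin k => p i) (fun i => hd i) (fun i => hp i)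
  have : (Matrix.of fun i j : Fin k => L (p i * p j)) =
      (Matrix.of fun i j : Fin k => (p j).coeff i)ᵀ * momentMatrix L k *
        (Matrix.of fun i j : Fin k => (p j).coeff i) := by
    ext i j
    have hlt : ∀ i : Fin k, (p i).degree < k := fun i => by
      rw [degree_eq_natDegree (hp i).ne_zero, hd]; exact_mod_cast i.2
    rw [of_apply, mul_comm, ← polyOfVec_coeff (hlt i), ← polyOfVec_coeff (hlt j), map_polyOfVec_mul,
      dotProduct_mulVec, mul_apply]
    simp only [dotProduct, vecMul, mul_apply, transpose_apply, of_apply]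
  rw [this, det_mul, det_mul, det_transpose, hT, one_mul, mul_one]

variable {β c : ℝ}

/-- The orthonormal functions spanning the range of the Christoffel–Darboux kernel. -/
noncomputable def meixnerFunction (β c : ℝ) (x j : ℕ) : ℝ :=
  √(meixnerWeight β c x) * monicMeixner β c j x / √(meixnerNormSq β c j)

/-- The finite-rank form is the sum over orthonormal functions; Christoffel–Darboux for that
reproducing kernel, off and on the diagonal, gives the two cases of the definition. -/
theorem meixnerKernel_eq_sum (hβ : 0 < β) (hc0 : 0 < c) (hc1 : c < 1) (m : ℕ) :
    meixnerKernel (m + 1) β c = fun x y =>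
      ∑ j : Fin (m + 1), meixnerFunction β c x j * meixnerFunction β c y j := by
  have hp := isMonicOP_meixnerPoly hβ hc0 hc1
  have hN : ∀ j, meixnerFunctional hβ hc0 hc1 (meixnerPoly β c j * meixnerPoly β c j) ≠ 0 :=
    fun j => by
      rw [← meixnerNormSq_eq_functional hβ hc0 hc1]; exact (meixnerNormSq_pos hβ hc0 hc1 j).ne'
  have hR := isReproducing_sum_monicOP hp hN (m + 1)
  have hL : MomentDefinite (meixnerFunctional hβ hc0 hc1) (m + 1) :=
    momentDefinite_seriesFunctional _ (meixnerWeight_pos hβ hc0) _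
  have hfun : ∀ n, monicMeixner β c n = fun ζ => (meixnerPoly β c n).eval ζ := fun n =>
    funext fun ζ => (eval_meixnerPoly β c n ζ).symm
  have hval : ∀ x y : ℝ, (∑ j ∈ Finset.range (m + 1), C ((meixnerPoly β c j).eval y /
      meixnerFunctional hβ hc0 hc1 (meixnerPoly β c j * meixnerPoly β c j)) *
        meixnerPoly β c j).eval x = ∑ j ∈ Finset.range (m + 1),
          monicMeixner β c j x * monicMeixner β c j y / meixnerNormSq β c j := fun x y => by
    rw [eval_finsetSum]
    refine Finset.sum_congr rfl fun j _ => ?_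
    rw [eval_mul, eval_C, eval_meixnerPoly, eval_meixnerPoly, meixnerNormSq_eq_functional hβ hc0 hc1]
    ring
  have hsum : ∀ x y : ℕ, ∑ j : Fin (m + 1), meixnerFunction β c x j * meixnerFunction β c y j =
      √(meixnerWeight β c x * meixnerWeight β c y) * ∑ j ∈ Finset.range (m + 1),
        monicMeixner β c j x * monicMeixner β c j y / meixnerNormSq β c j := fun x y => by
    rw [Fin.sum_univ_eq_sum_range fun j => meixnerFunction β c x j * meixnerFunction β c y j,
      Finset.mul_sum]
    refine Finset.sum_congr rfl fun j _ => ?_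
    have h := (meixnerNormSq_pos hβ hc0 hc1 j).le
    rw [meixnerFunction, meixnerFunction, Real.sqrt_mul (meixnerWeight_pos hβ hc0 x).le,
      div_mul_div_comm, Real.mul_self_sqrt h]
    ring
  have hNm := (meixnerNormSq_pos hβ hc0 hc1 m).ne'
  funext x y
  rw [hsum, meixnerKernel, Nat.add_sub_cancel]
  split_ifs with hxy
  · subst hxy
    have h := hR.christoffel_darboux_diag hL (hp (m + 1)) (hp m) x
    rw [hval, ← meixnerNormSq_eq_functional hβ hc0 hc1] at h
    rw [Real.sqrt_mul_self (meixnerWeight_pos hβ hc0 x).le]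
    rw [hfun (m + 1), hfun m, Polynomial.deriv, Polynomial.deriv, ← h]
    field_simp
  · have h := hR.christoffel_darboux_eval hL (hp (m + 1)) (hp m) x y
    rw [hval, ← meixnerNormSq_eq_functional hβ hc0 hc1] at h
    simp only [eval_meixnerPoly] at h
    have hne : (x : ℝ) - y ≠ 0 := sub_ne_zero.2 (by exact_mod_cast hxy)
    rw [show monicMeixner β c (m + 1) x * monicMeixner β c m y -
      monicMeixner β c m x * monicMeixner β c (m + 1) y = meixnerNormSq β c m * ((x - y) *
        ∑ j ∈ Finset.range (m + 1),
          monicMeixner β c j x * monicMeixner β c j y / meixnerNormSq β c j) by rw [h]; ring]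
    field_simp

theorem hasSum_meixnerFunction_mul (hβ : 0 < β) (hc0 : 0 < c) (hc1 : c < 1) (i j : ℕ) :
    HasSum (fun x => meixnerFunction β c x i * meixnerFunction β c x j) (if i = j then 1 else 0) := by
  have hp := isMonicOP_meixnerPoly hβ hc0 hc1
  have h := ((summable_meixnerWeight_mul_eval hβ hc0 hc1
    (meixnerPoly β c i * meixnerPoly β c j)).hasSum).div_const
      (√(meixnerNormSq β c i) * √(meixnerNormSq β c j))
  have hval : (∑' x : ℕ, meixnerWeight β c x * (meixnerPoly β c i * meixnerPoly β c j).eval (x : ℝ)) /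
      (√(meixnerNormSq β c i) * √(meixnerNormSq β c j)) = if i = j then 1 else 0 := by
    have : (∑' x : ℕ, meixnerWeight β c x * (meixnerPoly β c i * meixnerPoly β c j).eval (x : ℝ)) =
      meixnerFunctional hβ hc0 hc1 (meixnerPoly β c i * meixnerPoly β c j) := rfl
    rw [this]
    split_ifs with hij
    · subst hij
      have hpos := meixnerNormSq_pos hβ hc0 hc1 i
      rw [← meixnerNormSq_eq_functional hβ hc0 hc1, Real.mul_self_sqrt hpos.le, div_self hpos.ne']
    · rcases lt_or_gt_of_ne hij with hlt | hlt
      · rw [mul_comm (meixnerPoly β c i), (hp j).orth _ (by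
          rw [(hp i).degree_eq]; exact_mod_cast hlt), zero_div]
      · rw [(hp i).orth _ (by rw [(hp j).degree_eq]; exact_mod_cast hlt), zero_div]
  rw [hval] at h
  refine (congrArg (fun f => HasSum f _) (funext fun x => ?_)).mp h
  have hw := Real.mul_self_sqrt (meixnerWeight_pos hβ hc0 x).le
  rw [eval_mul, eval_meixnerPoly, eval_meixnerPoly, meixnerFunction, meixnerFunction,
    div_mul_div_comm]
  congr 1
  linear_combination -(monicMeixner β c i x * monicMeixner β c j x) * hw

theorem tsum_Ici_eq_sub_sum_range {f : ℕ → ℝ} {a : ℝ} (hf : HasSum f a) (s : ℕ) :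
    ∑' x : Set.Ici s, f x = a - ∑ x ∈ Finset.range s, f x := by
  have h := hf.summable.sum_add_tsum_compl (s := Finset.range s)
  have hs : Set.Ici s = ((Finset.range s : Finset ℕ) : Set ℕ)ᶜ := by ext; simp
  rw [hs, ← hf.tsum_eq, ← h]; ring

theorem restrictKernel_meixnerKernel (hβ : 0 < β) (hc0 : 0 < c) (hc1 : c < 1) (m s : ℕ) :
    restrictKernel (meixnerKernel (m + 1) β c) s = fun x y : Set.Ici s =>
      ∑ j : Fin (m + 1), meixnerFunction β c x j * meixnerFunction β c y j := by
  rw [meixnerKernel_eq_sum hβ hc0 hc1]; rfl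

theorem summable_fredholmTerm_meixnerKernel (hβ : 0 < β) (hc0 : 0 < c) (hc1 : c < 1) (m s : ℕ) :
    Summable (fredholmTerm (restrictKernel (meixnerKernel (m + 1) β c) s)) := by
  rw [restrictKernel_meixnerKernel hβ hc0 hc1]
  exact summable_fredholmTerm_finiteRank
    (fun (x : Set.Ici s) (j : Fin (m + 1)) => meixnerFunction β c x j)
    fun i j => (hasSum_meixnerFunction_mul hβ hc0 hc1 i j).summable.subtype _

theorem meixnerD_eq_det (hβ : 0 < β) (hc0 : 0 < c) (hc1 : c < 1) (m s : ℕ) :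
    meixnerD (m + 1) β c s = (momentMatrix (discreteFunctional (meixnerWeight β c) s) (m + 1)).det /
      ∏ j ∈ Finset.range (m + 1), meixnerNormSq β c j := by
  have hp := isMonicOP_meixnerPoly hβ hc0 hc1
  rw [meixnerD, restrictKernel_meixnerKernel hβ hc0 hc1, fredholmDet_finiteRank
    (fun (x : Set.Ici s) (j : Fin (m + 1)) => meixnerFunction β c x j)
    fun i j => (hasSum_meixnerFunction_mul hβ hc0 hc1 i j).summable.subtype _]
  -- Orthonormality on all nonnegative integers turns 1 minus the sum over x ≥ s into the sum over x
  -- < s; the normalizing factors come out as row and column scalings.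
  have hA : (1 - Matrix.of fun i j : Fin (m + 1) =>
      ∑' x : Set.Ici s, meixnerFunction β c x i * meixnerFunction β c x j) =
      Matrix.of fun i j : Fin (m + 1) => (√(meixnerNormSq β c i))⁻¹ *
        (Matrix.of fun i j : Fin (m + 1) => (√(meixnerNormSq β c j))⁻¹ *
          (Matrix.of fun i j : Fin (m + 1) => discreteFunctional (meixnerWeight β c) s
            (meixnerPoly β c i * meixnerPoly β c j)) i j) i j := by
    ext i j
    rw [Matrix.sub_apply, of_apply, of_apply, of_apply, of_apply,
      tsum_Ici_eq_sub_sum_range (hasSum_meixnerFunction_mul hβ hc0 hc1 i j), one_apply]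
    simp only [Fin.ext_iff, sub_sub_cancel]
    rw [discreteFunctional_apply, Finset.mul_sum, Finset.mul_sum]
    refine Finset.sum_congr rfl fun x _ => ?_
    have hw := Real.mul_self_sqrt (meixnerWeight_pos hβ hc0 x).le
    rw [eval_mul, eval_meixnerPoly, eval_meixnerPoly, meixnerFunction, meixnerFunction,
      div_eq_mul_inv, div_eq_mul_inv]
    linear_combination (√(meixnerNormSq β c i))⁻¹ * (√(meixnerNormSq β c j))⁻¹ *
      (monicMeixner β c i x * monicMeixner β c j x) * hw
  rw [hA, det_mul_column, det_mul_row,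
    det_map_mul_eq_det_momentMatrix (fun j => (hp j).monic) (fun j => (hp j).natDegree_eq), ← mul_assoc,
    ← Finset.prod_mul_distrib,
    Fin.prod_univ_eq_prod_range fun j => (√(meixnerNormSq β c j))⁻¹ * (√(meixnerNormSq β c j))⁻¹,
    Finset.prod_congr rfl fun j _ => by
      rw [← mul_inv, Real.mul_self_sqrt (meixnerNormSq_pos hβ hc0 hc1 j).le],
    Finset.prod_inv_distrib, div_eq_inv_mul]

theorem meixnerD_first (hβ : 0 < β) (hc0 : 0 < c) (hc1 : c < 1) (m : ℕ) :
    meixnerD (m + 1) β c (m + 1) = (1 - c) ^ (((m + 1 : ℕ) : ℝ) * (β + (m + 1 : ℕ) - 1)) := by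
  have hlt : (0 : ℝ) < 1 - c := by linarith
  rw [meixnerD_eq_det hβ hc0 hc1, det_momentMatrix_self, ← Finset.prod_div_distrib]
  have h : ∀ x ∈ Finset.range (m + 1), meixnerWeight β c x * (x ! : ℝ) ^ 2 / meixnerNormSq β c x =
      (1 - c) ^ (β + 2 * x) := fun x _ => by
    have h1 := (poch_pos hβ x).ne'
    have h2 := (Real.rpow_pos_of_pos hlt (β + 2 * x)).ne'
    rw [meixnerNormSq_eq hβ hc0 hc1, meixnerWeight, Real.rpow_neg hlt.le]
    field_simp
  rw [Finset.prod_congr rfl h]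
  clear h
  induction m with
  | zero => simp
  | succ m ih =>
    rw [Finset.prod_range_succ, ih, ← Real.rpow_add hlt]
    congr 1
    push_cast
    ring

theorem meixnerD_pos (hβ : 0 < β) (hc0 : 0 < c) (hc1 : c < 1) {m s : ℕ} (hms : m + 1 ≤ s) :
    0 < meixnerD (m + 1) β c s := by
  rw [meixnerD_eq_det hβ hc0 hc1]
  refine div_pos (det_momentMatrix_pos (meixnerWeight_pos hβ hc0) hms ?_)
    (Finset.prod_pos fun j _ => meixnerNormSq_pos hβ hc0 hc1 j)
  rw [det_momentMatrix_self]
  exact Finset.prod_pos fun x _ => mul_pos (meixnerWeight_pos hβ hc0 x) (by positivity)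

theorem meixnerD_succ (hβ : 0 < β) (hc0 : 0 < c) (hc1 : c < 1) {m s : ℕ} (hms : m + 1 ≤ s) :
    meixnerD (m + 1) β c (s + 1) = meixnerD (m + 1) β c s * (1 + meixnerWeight β c s *
      (reprKernel (discreteFunctional (meixnerWeight β c) s) (m + 1) s).eval (s : ℝ)) := by
  rw [meixnerD_eq_det hβ hc0 hc1, meixnerD_eq_det hβ hc0 hc1,
    det_momentMatrix_succ (meixnerWeight_pos hβ hc0) hms]
  ring

theorem meixnerD_second (hβ : 0 < β) (hc0 : 0 < c) (hc1 : c < 1) (m : ℕ) :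
    meixnerD (m + 1) β c (m + 1 + 1) = poch β (m + 1) / ((m + 1)! : ℝ) * c ^ (m + 1) *
      (1 - c) ^ (((m + 1 : ℕ) : ℝ) * (β + (m + 1 : ℕ) - 1)) *
        ₂F₁ (-((m + 1 : ℕ) : ℝ)) (-((m + 1 : ℕ) : ℝ)) β (1 / c) := by
  rw [meixnerD_succ hβ hc0 hc1 le_rfl, meixnerD_first hβ hc0 hc1,
    reprKernel_eval_next (meixnerWeight_pos hβ hc0), hypergeometric_neg_nat_neg_nat,
    -- The last summand of the hypergeometric sum, multiplied by the weight at m + 1, is the 1 in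
    -- the determinant ratio.
    Finset.sum_range_succ _ (m + 1)]
  have h : ∀ i ∈ Finset.range (m + 1), ((m + 1).choose i : ℝ) * ((m + 1).choose i : ℝ) * (i ! : ℝ) /
      poch β i * (1 / c) ^ i = ((m + 1).choose i : ℝ) ^ 2 / meixnerWeight β c i := fun i _ => by
    have h1 := (poch_pos hβ i).ne'
    rw [meixnerWeight, div_pow, one_pow]
    field_simp
  rw [Finset.sum_congr rfl h, Nat.choose_self, meixnerWeight]
  have h1 := (poch_pos hβ (m + 1)).ne'
  rw [div_pow, one_pow]
  field_simp
  push_cast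
  ring

end MeixnerDeterminant

/-! ### Initial values, uniqueness and the difference Painlevé V step. -/

section MeixnerSolution

variable {β c : ℝ}

/-- The lower form of e_k is used because -β, unlike 0, is not a node, so
`levelNorm_mul_opRatio_first` applies. -/
theorem seqE_first (hβ : 0 < β) (hc0 : 0 < c) (m : ℕ) :
    ₂F₁ (-(m : ℝ)) (-(m : ℝ)) (1 + β) (1 / c) ≠ 0 ∧ seqE (meixnerWeight β c) m (m + 1) =
      β * c * (m ! : ℝ) ^ 2 / ₂F₁ (-(m : ℝ)) (-(m : ℝ)) (1 + β) (1 / c) := by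
  have hw := isPearsonWeight_meixnerWeight hβ hc0
  have hne : ∀ x ≤ m, (x : ℝ) ≠ -β := fun x _ => by
    have : (0 : ℝ) ≤ x := x.cast_nonneg
    linarith
  have h := levelNorm_mul_opRatio_first hw.pos
    (monicOP_eval_ne_zero_left (z := -β) hw.pos le_rfl (by linarith)) hne
  have hsum : ∑ i ∈ Finset.range (m + 1), (m.choose i : ℝ) ^ 2 /
      ((-β - i) * meixnerWeight β c i) = -(₂F₁ (-(m : ℝ)) (-(m : ℝ)) (1 + β) (1 / c) / β) := by
    rw [hypergeometric_neg_nat_neg_nat, Finset.sum_div, ← Finset.sum_neg_distrib]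
    refine Finset.sum_congr rfl fun i _ => ?_
    have h1 := poch_succ β i
    have h2 := poch_add β 1 i
    rw [add_comm 1 i, h1, poch_succ β 0, poch_zero] at h2
    have h3 := (poch_pos (by linarith : 0 < 1 + β) i).ne'
    have h4 := (poch_pos hβ i).ne'
    have h5 : (-β - i) * meixnerWeight β c i = -(β * poch (1 + β) i * c ^ i / i !) := by
      rw [meixnerWeight]
      have : poch β i * (β + i) = β * poch (1 + β) i := by
        rw [h2, add_comm 1 β]; push_cast; ring
      field_simp
      linear_combination -this
    rw [h5, div_pow, one_pow]
    field_simp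
  rw [hsum] at h
  have hm : (m ! : ℝ) ^ 2 ≠ 0 := by positivity
  have hF : ₂F₁ (-(m : ℝ)) (-(m : ℝ)) (1 + β) (1 / c) ≠ 0 := fun h0 => by
    rw [h0] at h; exact hm (by rw [← h]; ring)
  refine ⟨hF, ?_⟩
  rw [seqE_eq_lower hw hβ hc0 le_rfl, ← h]
  field_simp

theorem seqG_first (hβ : 0 < β) (hc0 : 0 < c) (m : ℕ) :
    ₂F₁ (-((m + 1 : ℕ) : ℝ)) (-(m : ℝ)) β (1 / c) ≠ 0 ∧ seqG (meixnerWeight β c) m (m + 1) =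
      (m + 1 : ℕ) / (β * c) * (₂F₁ (-(m : ℝ)) (-(m : ℝ)) (1 + β) (1 / c) /
        ₂F₁ (-((m + 1 : ℕ) : ℝ)) (-(m : ℝ)) β (1 / c)) := by
  have hw := isPearsonWeight_meixnerWeight hβ hc0
  have hne : ∀ x ≤ m, (x : ℝ) ≠ (m + 1 : ℕ) := fun x hx => by exact_mod_cast (by omega : x ≠ m + 1)
  have h := levelNorm_mul_opRatio_first hw.pos
    (monicOP_eval_ne_zero_right (z := (m + 1 : ℕ)) hw.pos le_rfl (by linarith)) hne
  have hsum : ∑ i ∈ Finset.range (m + 1), (m.choose i : ℝ) ^ 2 /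
      (((m + 1 : ℕ) - i) * meixnerWeight β c i) =
      ₂F₁ (-((m + 1 : ℕ) : ℝ)) (-(m : ℝ)) β (1 / c) / (m + 1 : ℕ) := by
    rw [hypergeometric_neg_nat_neg_nat, Finset.sum_range_succ _ (m + 1), Nat.choose_succ_self,
      Nat.cast_zero, mul_zero, zero_mul, zero_div, zero_mul, add_zero, Finset.sum_div]
    refine Finset.sum_congr rfl fun i hi => ?_
    have him : i ≤ m := Nat.lt_succ_iff.1 (Finset.mem_range.1 hi)
    have h1 := Nat.choose_mul_succ_eq m i
    have h2 : (m.choose i : ℝ) * (m + 1 : ℕ) = (m + 1).choose i * ((m + 1 : ℕ) - i) := by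
      rw [← Nat.cast_sub (by omega : i ≤ m + 1)]; exact_mod_cast h1
    have h3 : ((m + 1 : ℕ) : ℝ) - i ≠ 0 := sub_ne_zero.2 (hne i him).symm
    have h4 := (poch_pos hβ i).ne'
    have h5 : ((m + 1 : ℕ) : ℝ) ≠ 0 := by positivity
    rw [meixnerWeight, div_pow, one_pow, div_eq_div_iff (by positivity) h5]
    field_simp
    linear_combination (m.choose i : ℝ) * h2
  rw [hsum] at h
  have hm : (m ! : ℝ) ^ 2 ≠ 0 := by positivity
  have hF : ₂F₁ (-((m + 1 : ℕ) : ℝ)) (-(m : ℝ)) β (1 / c) ≠ 0 := fun h0 => by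
    rw [h0] at h; exact hm (by rw [← h]; ring)
  refine ⟨hF, ?_⟩
  obtain ⟨hF1, hE⟩ := seqE_first hβ hc0 m
  have hE' := seqE_eq_lower hw hβ hc0 (le_refl (m + 1))
  have hG := seqG_eq_lower hw hβ hc0 (le_refl (m + 1))
  have hN : levelNorm (meixnerWeight β c) m (m + 1) ≠ 0 := (monicOP_norm_pos hw.pos le_rfl).ne'
  have hb := (opRatio_neg hw.pos (le_refl (m + 1)) (by linarith : -β < 0)).ne
  have hk : ((m + 1 : ℕ) : ℝ) ≠ 0 := by positivity
  -- In the product e_k g_k the ratio at -β cancels, leaving the norm times the ratio at the next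
  -- node k, which is the quantity computed in `h`.
  have hmul : seqE (meixnerWeight β c) m (m + 1) * seqG (meixnerWeight β c) m (m + 1) =
      levelNorm (meixnerWeight β c) m (m + 1) *
        opRatio (discreteFunctional (meixnerWeight β c) (m + 1)) m (m + 1 : ℕ) := by
    rw [hE', hG]; field_simp
  rw [← hmul, hE] at h
  field_simp at h ⊢
  exact h

theorem isMeixnerSolution_seq (hβ : 0 < β) (hc0 : 0 < c) (hc1 : c < 1) (m : ℕ) :
    IsMeixnerSolution (m + 1) β c (seqE (meixnerWeight β c) m) (seqF (meixnerWeight β c) m)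
      (seqG (meixnerWeight β c) m) (seqH (meixnerWeight β c) m) := by
  have hw := isPearsonWeight_meixnerWeight hβ hc0
  have hk1 : 1 - ((m + 1 : ℕ) : ℝ) = -(m : ℝ) := by push_cast; ring
  have hk2 : ∀ x : ℝ, x + β + (m + 1 : ℕ) - 1 = x + (β + m) := fun x => by push_cast; ring
  have hk3 : β + (m + 1 : ℕ) - 1 = β + m := by push_cast; ring
  have hk4 : ∀ s : ℕ, ∀ x : ℝ, x + (m + 1 : ℕ) - s - 1 = x + (β + m) - (β + s) := fun s x => by
    push_cast; ring
  have hG := fun s (hs : m + 1 ≤ s) => seqG_pos hw hs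
  have hF := fun s (hs : m + 1 ≤ s) => seqF_succ_pos hw hs
  obtain ⟨hF1, hE1⟩ := seqE_first hβ hc0 m
  obtain ⟨hF2, hG1⟩ := seqG_first hβ hc0 m
  constructor
  · rw [hk1]; exact ⟨hF1, hF2⟩
  · rw [hk1, hE1, Nat.add_sub_cancel]
  · exact seqF_first hw.pos
  · rw [hk1, hG1]
  · exact seqH_first hw.pos
  · exact fun s hs => (seqE_pos hw hs).ne'
  · exact fun s hs => (hG s hs).ne'
  · exact fun s hs => by have := hG s hs; positivity
  · exact fun s hs => by have := hG s hs; positivity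
  · exact fun s hs => (hF s hs).ne'
  · exact fun s hs => by have := hF s hs; rw [hk2]; positivity
  · exact fun s hs => by rw [hk4]; exact seqF_den_ne_zero hw hβ hc1 hs
  · exact fun s hs => by rw [hk3, hk4]; exact seqE_succ hw hβ hc0 hc1 hs
  · intro s hs
    rw [seqF_succ hw hβ hc0 hs]
    push_cast
    ring
  · intro s hs
    rw [hk2, seqG_succ hw hβ hc0 hs]
    push_cast
    rfl
  · exact fun s hs => seqH_succ hw hβ hc0 hs

theorem IsMeixnerSolution.unique {k : ℕ} {e f g h e' f' g' h' : ℕ → ℝ}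
    (H : IsMeixnerSolution k β c e f g h) (H' : IsMeixnerSolution k β c e' f' g' h') {s : ℕ}
    (hs : k ≤ s) : e s = e' s ∧ f s = f' s ∧ g s = g' s ∧ h s = h' s := by
  induction s, hs using Nat.le_induction with
  | base => exact ⟨by rw [H.init_e, H'.init_e], by rw [H.init_f, H'.init_f],
      by rw [H.init_g, H'.init_g], by rw [H.init_h, H'.init_h]⟩
  | succ s hs ih =>
    obtain ⟨he, hf, hg, hh⟩ := ih
    have hf' : f (s + 1) = f' (s + 1) := by rw [H.rec_f s hs, H'.rec_f s hs, hf, hg]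
    have hg' : g (s + 1) = g' (s + 1) := by rw [H.rec_g s hs, H'.rec_g s hs, hf', hg]
    exact ⟨by rw [H.rec_e s hs, H'.rec_e s hs, hf', hg', he, hg], hf', hg',
      by rw [H.rec_h s hs, H'.rec_h s hs, hf', hg, hh]⟩

theorem IsMeixnerSolution.isDPVStep {k : ℕ} {e f g h : ℕ → ℝ} (hc0 : 0 < c)
    (H : IsMeixnerSolution k β c e f g h) {s : ℕ} (hs : k ≤ s) :
    IsDPVStep c (meixnerDPVState k β f g s) (meixnerDPVState k β f g (s + 1)) := by
  have hshift : (meixnerDPVState k β f g s).shift = 1 := by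
    simp only [DPVState.shift, meixnerDPVState]; ring
  have hfa : f (s + 1) - -((k : ℝ) + β - 1) = f (s + 1) + β + k - 1 := by ring
  have hne := mul_ne_zero (mul_ne_zero hc0.ne' (H.f_ne s hs)) (H.f_add_ne s hs)
  constructor
  · rw [hshift]; simp only [meixnerDPVState]; push_cast; ring
  · rw [hshift]; simp only [meixnerDPVState]; push_cast; ring
  · rw [hshift]; simp only [meixnerDPVState]; push_cast; ring
  · rfl
  · rfl
  · exact H.one_add_g_ne s hs
  · exact H.one_add_cg_ne s hs
  · simp only [meixnerDPVState]; rw [hfa]; exact hne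
  · simp only [meixnerDPVState]; rw [H.rec_f s hs]; ring
  · rw [hshift]; simp only [meixnerDPVState]
    have h1 := H.f_ne s hs
    have h2 := H.f_add_ne s hs
    have h3 := H.g_ne s hs
    rw [hfa, H.rec_g s hs]
    field_simp
    ring

theorem meixnerD_ratio_difference (hβ : 0 < β) (hc0 : 0 < c) (hc1 : c < 1) {m s : ℕ}
    (hms : m + 1 ≤ s) {e f g h : ℕ → ℝ} (H : IsMeixnerSolution (m + 1) β c e f g h) :
    meixnerD (m + 1) β c (s + 2) / meixnerD (m + 1) β c (s + 1)
        - meixnerD (m + 1) β c (s + 1) / meixnerD (m + 1) β c s =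
      poch β s / (β + s) * (c ^ (s - 1) / ((s + 1)! : ℝ)) *
        ((1 + c * g s) / (e s * g s ^ 2)) * ((1 + c * g s) * f (s + 1) - s - 1) * h s ^ 2 := by
  have hseq := isMeixnerSolution_seq hβ hc0 hc1 m
  obtain ⟨he, -, hg, hh⟩ := H.unique hseq hms
  obtain ⟨-, hf, -, -⟩ := H.unique hseq (hms.trans s.le_succ)
  have h0 := (meixnerD_pos hβ hc0 hc1 hms).ne'
  have h1 := (meixnerD_pos hβ hc0 hc1 (hms.trans s.le_succ)).ne'
  have hD := gap_ratio_difference (isPearsonWeight_meixnerWeight hβ hc0) hβ hc0 hms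
  rw [meixnerD_succ hβ hc0 hc1 (hms.trans s.le_succ), mul_div_cancel_left₀ _ h1,
    meixnerD_succ hβ hc0 hc1 hms, mul_div_cancel_left₀ _ h0, add_sub_add_left_eq_sub, hD,
    he, hg, hh, hf]
  have hcoef : meixnerWeight β c s / (c * (s + 1) * (β + s)) =
      poch β s / (β + s) * (c ^ (s - 1) / ((s + 1)! : ℝ)) := by
    -- Here s ≥ 1, so the exponent s - 1 is a true difference and absorbs the factor 1/c.
    obtain ⟨r, rfl⟩ : ∃ r, s = r + 1 := ⟨s - 1, by omega⟩
    rw [meixnerWeight, Nat.factorial_succ (r + 1), Nat.add_sub_cancel, pow_succ]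
    push_cast
    field_simp
  rw [hcoef]

end MeixnerSolution
theorem theorem11p3 (k : ℕ) (hk : 1 ≤ k) (β c : ℝ) (hβ : 0 < β) (hc0 : 0 < c) (hc1 : c < 1) :
    -- the Fredholm determinants are well defined, nonzero, with the stated initial values
    (∀ s, k ≤ s → Summable (fredholmTerm (restrictKernel (meixnerKernel k β c) s)) ∧
      meixnerD k β c s ≠ 0) ∧
    meixnerD k β c k = (1 - c) ^ ((k : ℝ) * (β + k - 1)) ∧
    meixnerD k β c (k + 1) = poch β k / (k ! : ℝ) * c ^ k *
      (1 - c) ^ ((k : ℝ) * (β + k - 1)) * ₂F₁ (-(k : ℝ)) (-(k : ℝ)) β (1 / c) ∧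
    -- the recurrences can be run from the initial values without meeting a zero denominator
    (∃ e f g h : ℕ → ℝ, IsMeixnerSolution k β c e f g h) ∧
    -- the resulting sequences compute the Fredholm determinants, and `f, g` solve `d-P_V`
    (∀ e f g h : ℕ → ℝ, IsMeixnerSolution k β c e f g h → ∀ s, k ≤ s →
      meixnerD k β c (s + 2) / meixnerD k β c (s + 1)
          - meixnerD k β c (s + 1) / meixnerD k β c s =
        poch β s / (β + s) * (c ^ (s - 1) / ((s + 1)! : ℝ)) *
          ((1 + c * g s) / (e s * g s ^ 2)) *
          ((1 + c * g s) * f (s + 1) - s - 1) * h s ^ 2 ∧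
      IsDPVStep c (meixnerDPVState k β f g s) (meixnerDPVState k β f g (s + 1))) := by
  -- The index m = k - 1 is the degree of the lower polynomial in the Christoffel–Darboux formula.
  obtain ⟨m, rfl⟩ : ∃ m, k = m + 1 := ⟨k - 1, by omega⟩
  exact ⟨fun s hs => ⟨summable_fredholmTerm_meixnerKernel hβ hc0 hc1 m s,
      (meixnerD_pos hβ hc0 hc1 hs).ne'⟩, meixnerD_first hβ hc0 hc1 m, meixnerD_second hβ hc0 hc1 m,
    ⟨_, _, _, _, isMeixnerSolution_seq hβ hc0 hc1 m⟩,
    fun _ _ _ _ H _ hs => ⟨meixnerD_ratio_difference hβ hc0 hc1 hs H, H.isDPVStep hc0 hs⟩⟩
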